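/- Let $K\subset\mathbb R^n$ be a nonempty compact convex set with diameter $d$, and let $\sigma>0$. For $Y=\mu+\xi$ with $\mu\in K$ and $\xi\sim N(0,\sigma^2\mathbb I_n)$, let $\hat\mu=\hat\mu(Y)=\operatorname{argmin}_{\nu\in K}\|Y-\nu\|^2$ be the least squares estimator, and let $\varepsilon_K(\sigma)\ge 0$ be its worst case rate, $\varepsilon_K(\sigma)^2=\sup_{\mu\in K}\mathbb E\|\hat\mu-\mu\|^2$. For $\nu\in K$ and $r\ge 0$ let $w_\nu(r)=\mathbb E\sup_{t\in B(\nu,r)\cap K}\langle x,t\rangle$, $x\sim N(0,\mathbb I_n)$, where $B(\nu,r)$ is the closed Euclidean ball. A $\delta$-packing of $T$ is a subset of $T$ whose distinct points are at distance $>\delta$; it is called maximal if it has the largest possible number of points. Let $c^*>4$ and put $$C=4-\frac1{{c^*}^2},\qquad c'=\frac{(2c^*-4)(4c^*-1/c^*)}{(c^*-4)c^*}.$$ The local packing algorithm is the following breadth-first search. Its queue initially contains one arbitrary point $\nu^*\in K$, of level $1$. The node $\nu$ at the head of the (first in, first out) queue is removed; let $k$ be its level and $\delta=d/(2^{k-1}c^*)$.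 A maximal $\delta$-packing $\{\nu_1,\dots,\nu_M\}$ of $B(\nu,\delta c^*)\cap K$ is formed. If $$w_\nu(\delta c^*)-\min_{1\le i\le M}w_{\nu_i}(\delta)-\frac{C(\delta c^*)^2}{2\sigma}>0,$$ the algorithm stops and returns $\delta=d/(2^{k-1}c^*)$. Otherwise $\nu_1,\dots,\nu_M$ are appended to the queue as nodes of level $k+1$, and the search continues with the next node in the queue. The processing of all the nodes of one level counts as one iteration: the algorithm *terminates after $k$ iterations* if it stops while processing a node of level $k$, and it *does not terminate within $k$ iterations* if it does not stop at any node of level at most $k$. There are absolute constants $a,A>0$ (independent of $n$, $K$, $\sigma$, $c^*$, $k$ and of the choices of the root and of the packings) such that for every $k\ge 1$: 1. If the algorithm terminates after $k$ iterations, then $\varepsilon_K(\sigma)\ge a\,\dfrac{d}{2^{k-1}c^*}$. 2. If the algorithm does not terminate within $k$ iterations, then - (a) if $\sigma\ge c'\,\dfrac{d}{2^k}$, then $a\min(\sigma,d)\le\varepsilon_K(\sigma)\le A\min(\sigma,d)$; - (b) if $\sigma\le c'\,\dfrac{d}{2^k}$, then $\varepsilon_K(\sigma)\le A\,c'\,\dfrac{d}{2^k}$.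 -/

import Mathlib

open MeasureTheory ProbabilityTheory

namespace LocalPacking

noncomputable section

/-- Euclidean space `ℝⁿ`. -/
abbrev E (n : ℕ) : Type := EuclideanSpace ℝ (Fin n)

/-- The Gaussian width `w(T) = 𝔼 sup_{t ∈ T} ⟨x, t⟩`, where `x ∼ N(0, Iₙ)`. -/
def gaussianWidth {n : ℕ} (T : Set (E n)) : ℝ :=
  ∫ x, sSup ((fun t => inner ℝ x t) '' T) ∂(stdGaussian (E n))

/-- The local Gaussian width `w_ν(r) = w(B(ν, r) ∩ K)`, with `B(ν, r)` the closed ball. -/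
def localWidth {n : ℕ} (K : Set (E n)) (ν : E n) (r : ℝ) : ℝ :=
  gaussianWidth (Metric.closedBall ν r ∩ K)

/-- The least squares estimator: the minimizer of `‖y - ν‖²` over `ν ∈ K`
(it exists and is unique when `K` is nonempty, closed and convex). -/
def lse {n : ℕ} (K : Set (E n)) (y : E n) : E n :=
  Classical.epsilon fun ν => ν ∈ K ∧ IsMinOn (fun η => ‖y - η‖ ^ 2) K ν

/-- The risk `𝔼 ‖μ̂(Y) - μ‖²` of the least squares estimator, where `Y = μ + ξ` and
`ξ = σ z ∼ N(0, σ² Iₙ)`, `z ∼ N(0, Iₙ)`. -/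
def lseRisk {n : ℕ} (K : Set (E n)) (σ : ℝ) (μ : E n) : ℝ :=
  ∫ z, ‖lse K (μ + σ • z) - μ‖ ^ 2 ∂(stdGaussian (E n))

/-- The worst case rate `ε_K(σ)`, defined by `ε_K(σ)² = sup_{μ ∈ K} 𝔼 ‖μ̂(Y) - μ‖²`. -/
def worstCaseRate {n : ℕ} (K : Set (E n)) (σ : ℝ) : ℝ :=
  Real.sqrt (sSup (lseRisk K σ '' K))

/-- `P` lists, without repetition, the elements of a `δ`-packing of `T` (a subset of `T` whose
distinct points are at distance `> δ`) with the largest possible number `M(δ, T)` of elements. -/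
structure IsMaxPacking {n : ℕ} (δ : ℝ) (T : Set (E n)) (P : List (E n)) : Prop where
  nodup : P.Nodup
  subset : ∀ p ∈ P, p ∈ T
  separated : Metric.IsSeparated (ENNReal.ofReal δ) {p | p ∈ P}
  card_eq : (P.length : ℕ∞) = Metric.packingNumber δ.toNNReal T

/-- The packing scale `δ = d / (2^(k-1) c)` at level `k ≥ 1`, where `d = diam K`. -/
def scale {n : ℕ} (K : Set (E n)) (c : ℝ) (k : ℕ) : ℝ :=
  Metric.diam K / (2 ^ (k - 1) * c)

/-- `IsChildrenDistance K σ c ν k P γ`: a call of the subroutine `ChildrenDistance` at the node `ν`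
of level `k` may form the packing `P` and return the value `γ = Ψ - T`, where
`Ψ = w_ν(δ c) - min_i w_{ν_i}(δ)`, `T = C (δ c)² / (2σ)` and `C = 4 - 1 / c²`. -/
def IsChildrenDistance {n : ℕ} (K : Set (E n)) (σ c : ℝ) (ν : E n) (k : ℕ)
    (P : List (E n)) (γ : ℝ) : Prop :=
  IsMaxPacking (scale K c k) (Metric.closedBall ν (scale K c k * c) ∩ K) P ∧
  ∃ p ∈ P, (∀ q ∈ P, localWidth K p (scale K c k) ≤ localWidth K q (scale K c k)) ∧
    γ = (localWidth K ν (scale K c k * c) - localWidth K p (scale K c k))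
      - (4 - 1 / c ^ 2) * (scale K c k * c) ^ 2 / (2 * σ)

/-- A configuration of the algorithm: either it is still searching, with a queue of nodes `(ν, φ(ν))`
(points together with their level in the tree), or it has returned an output `β` while
processing a node of level `k`. -/
inductive Config (n : ℕ) : Type
  | searching (Q : List (E n × ℕ)) : Config n
  | returned (k : ℕ) (β : ℝ) : Config n

/-- One pass through the body of the `while` loop. The node at the end of the queue is removed;
the algorithm returns if `γ > 0`, and otherwise adds the children one by one, with their level
increased by one, to the start of the queue. The choice of the maximal packing is free. A
configuration that has returned, or whose queue is empty, does not change any more. -/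
inductive Step {n : ℕ} (K : Set (E n)) (σ c : ℝ) : Config n → Config n → Prop
  | halt (Q : List (E n × ℕ)) (ν : E n) (k : ℕ) (P : List (E n)) (γ : ℝ)
      (h : IsChildrenDistance K σ c ν k P γ) (hγ : 0 < γ) :
      Step K σ c (.searching (Q ++ [(ν, k)])) (.returned k (scale K c k))
  | expand (Q : List (E n × ℕ)) (ν : E n) (k : ℕ) (P : List (E n)) (γ : ℝ)
      (h : IsChildrenDistance K σ c ν k P γ) (hγ : γ ≤ 0) :
      Step K σ c (.searching (Q ++ [(ν, k)]))
        (.searching (P.reverse.map (fun p => (p, k + 1)) ++ Q))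
  | idle_returned (k : ℕ) (β : ℝ) : Step K σ c (.returned k β) (.returned k β)
  | idle_empty : Step K σ c (.searching []) (.searching [])

/-- An execution of the algorithm: the infinite sequence of its configurations, started with the
queue that holds only an arbitrary root `ν ∈ K`, of level `1`. -/
structure IsExecution {n : ℕ} (K : Set (E n)) (σ c : ℝ) (s : ℕ → Config n) : Prop where
  start : ∃ ν ∈ K, s 0 = .searching [(ν, 1)]
  step : ∀ t, Step K σ c (s t) (s (t + 1))

/-- The execution terminates after `k` iterations, i.e. at the `k`-th level of the tree (an
iteration of the breadth first search consists in the processing of one level). -/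
def TerminatesAfter {n : ℕ} (s : ℕ → Config n) (k : ℕ) : Prop :=
  ∃ t β, s t = .returned k β

/-- The execution terminates within `k` iterations, i.e. after at most `k` of them. -/
def TerminatesWithin {n : ℕ} (s : ℕ → Config n) (k : ℕ) : Prop :=
  ∃ j ≤ k, TerminatesAfter s j

/-- The constant `c' = (2c - 4)(4c - 1/c) / ((c - 4) c)`. -/
def cPrime (c : ℝ) : ℝ :=
  (2 * c - 4) * (4 * c - 1 / c) / ((c - 4) * c)

end

end LocalPacking

namespace LocalPacking

/-! ### Projection onto a convex body. -/

section Projection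

variable {n : ℕ} {K : Set (E n)}

/-! Fix `μ ∈ K` and let `F_r(x)` be the supremum of `⟨x, t - μ⟩` over `t ∈ B(μ, r) ∩ K`
(`localSupp`), with mean `w_μ(r)`. The distance `t` from the estimator to `μ` is tied to the growth
of `F` by deterministic inequalities: `t > 2M` forces `M t ≤ σ (F_{2M} - F_M)`, while `t ≤ s < R`
forces `σ (F_R - F_s) ≤ t (R - s)`. Both come from the variational inequality of the projection,
tested along a segment to the estimator. By a Gaussian Poincaré inequality `F_r` has variance at
most `6 r²`, so `F` may be replaced by its mean at a cost of order `σ²` in the risk. Hence slow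
growth of `w_μ` at scale `M ≥ σ` bounds the risk by a multiple of `M²`
(`lseRisk_le_of_localWidth_sub_le`), and fast growth from scale `s` gives `s² ≤ risk + 240 σ²`
(`sq_le_lseRisk_add`). A two-point argument shows that `min σ d` is always at most a multiple of the
worst case rate (`min_le_mul_worstCaseRate`); this absorbs the `σ²` in the lower bound.

If the search stops at scale `δ`, then `B(ν, cδ) ⊆ B(p, 2cδ)` for a packing point `p`, and the
constant `C` is such that the stopping test becomes fast growth of `w_p` between `δ` and `2cδ`.

If the search passes level `k`, breadth-first order ensures that for every `μ ∈ K` some expanded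
node of level `k` lies within `2δ` of `μ` or is the root, and in either case its ball contains `B(μ,
(c-2)δ) ∩ K`. The failed test then bounds the slope of `w_μ` on `[2δ, (c-2)δ]`. Since `w_μ` is
concave, this slope bound persists at every larger scale `M`, and `c'` is large enough to turn it
into slow growth. -/

lemma lse_spec (hK : IsCompact K) (hne : K.Nonempty) (y : E n) :
    lse K y ∈ K ∧ IsMinOn (fun η => ‖y - η‖ ^ 2) K (lse K y) := by
  refine Classical.epsilon_spec (p := fun ν => ν ∈ K ∧ IsMinOn (fun η => ‖y - η‖ ^ 2) K ν) ?_
  obtain ⟨v, hv, h⟩ := hK.exists_isMinOn hne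
    (f := fun η => ‖y - η‖ ^ 2) (by fun_prop)
  exact ⟨v, hv, h⟩

lemma lse_mem (hK : IsCompact K) (hne : K.Nonempty) (y : E n) : lse K y ∈ K :=
  (lse_spec hK hne y).1

/-- The first-order optimality condition of the projection. Every deterministic fact about the
estimator below is deduced from it. -/
lemma lse_inner_le (hK : IsCompact K) (hc : Convex ℝ K) (hne : K.Nonempty) (y : E n)
    {t : E n} (ht : t ∈ K) : inner ℝ (y - lse K y) (t - lse K y) ≤ 0 := by
  obtain ⟨hm, hmin⟩ := lse_spec hK hne y
  have : Nonempty K := ⟨⟨_, hm⟩⟩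
  refine (norm_eq_iInf_iff_real_inner_le_zero hc hm).1 ?_ t ht
  refine le_antisymm (le_ciInf fun w => ?_) (ciInf_le ⟨0, ?_⟩ (⟨_, hm⟩ : K))
  · exact (pow_le_pow_iff_left₀ (norm_nonneg _) (norm_nonneg _) two_ne_zero).1 (hmin w.2)
  · rintro _ ⟨w, rfl⟩
    exact norm_nonneg _

lemma norm_lse_sub_lse_le (hK : IsCompact K) (hc : Convex ℝ K) (hne : K.Nonempty) (y z : E n) :
    ‖lse K y - lse K z‖ ≤ ‖y - z‖ := by
  have h₁ := lse_inner_le hK hc hne y (lse_mem hK hne z)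
  have h₂ := lse_inner_le hK hc hne z (lse_mem hK hne y)
  set p := lse K y
  set q := lse K z
  -- Firm nonexpansiveness: the sum of the two variational inequalities. Cauchy-Schwarz then
  -- finishes.
  have h : ‖p - q‖ ^ 2 ≤ inner ℝ (y - z) (p - q) := by
    rw [← real_inner_self_eq_norm_sq]
    simp only [inner_sub_left, inner_sub_right] at *
    have := real_inner_comm p q
    linarith
  have h' := real_inner_le_norm (y - z) (p - q)
  by_contra! hlt
  nlinarith [norm_nonneg (y - z)]

lemma continuous_lse (hK : IsCompact K) (hc : Convex ℝ K) (hne : K.Nonempty) :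
    Continuous (lse K) := by
  refine (LipschitzWith.of_dist_le_mul (K := 1) fun y z => ?_).continuous
  simpa [dist_eq_norm] using norm_lse_sub_lse_le hK hc hne y z

end Projection

/-! ### Support functions and their smoothing. -/

section SupportFunction

variable {n : ℕ} {T : Set (E n)} {μ : E n} {r : ℝ}

/-- The support function `x ↦ sup_{t ∈ T} ⟨x, t - μ⟩` of `T` centred at `μ`. -/
noncomputable def suppFun (T : Set (E n)) (μ x : E n) : ℝ :=
  sSup ((fun t => inner ℝ x (t - μ)) '' T)

lemma inner_le_mul_of_mem_closedBall {t : E n} (x : E n) (ht : t ∈ Metric.closedBall μ r) :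
    inner ℝ x (t - μ) ≤ r * ‖x‖ := by
  rw [mem_closedBall_iff_norm] at ht
  calc inner ℝ x (t - μ) ≤ ‖x‖ * ‖t - μ‖ := real_inner_le_norm _ _
    _ ≤ r * ‖x‖ := by rw [mul_comm r]; gcongr

lemma bddAbove_inner (hT : T ⊆ Metric.closedBall μ r) (x : E n) :
    BddAbove ((fun t => inner ℝ x (t - μ)) '' T) := by
  refine ⟨r * ‖x‖, ?_⟩
  rintro _ ⟨t, ht, rfl⟩
  exact inner_le_mul_of_mem_closedBall x (hT ht)

lemma inner_le_suppFun (hT : T ⊆ Metric.closedBall μ r) (x : E n) {t : E n} (ht : t ∈ T) :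
    inner ℝ x (t - μ) ≤ suppFun T μ x :=
  le_csSup (bddAbove_inner hT x) ⟨t, ht, rfl⟩

lemma suppFun_le (hne : T.Nonempty) {x : E n} {b : ℝ} (h : ∀ t ∈ T, inner ℝ x (t - μ) ≤ b) :
    suppFun T μ x ≤ b := by
  refine csSup_le (hne.image _) ?_
  rintro _ ⟨t, ht, rfl⟩
  exact h t ht

lemma suppFun_le_add (hT : T ⊆ Metric.closedBall μ r) (hne : T.Nonempty) (x y : E n) :
    suppFun T μ x ≤ suppFun T μ y + r * ‖x - y‖ := by
  refine suppFun_le hne fun t ht => ?_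
  have h₁ := inner_le_suppFun hT y ht
  have h₂ := inner_le_mul_of_mem_closedBall (x - y) (hT ht)
  rw [inner_sub_left] at h₂
  linarith

lemma continuous_suppFun (hT : T ⊆ Metric.closedBall μ r) (hne : T.Nonempty) :
    Continuous (suppFun T μ) := by
  refine (LipschitzWith.of_le_add_mul r.toNNReal fun x y => ?_).continuous
  rw [dist_eq_norm]
  refine (suppFun_le_add hT hne x y).trans ?_
  gcongr
  exact Real.le_coe_toNNReal r

lemma abs_suppFun_le (hT : T ⊆ Metric.closedBall μ r) (hne : T.Nonempty) (x : E n) :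
    |suppFun T μ x| ≤ r * ‖x‖ := by
  have h0 : suppFun T μ 0 = 0 := by
    refine le_antisymm (suppFun_le hne fun t _ => by simp) ?_
    obtain ⟨t, ht⟩ := hne
    simpa using inner_le_suppFun hT 0 ht
  have h₁ := suppFun_le_add hT hne x 0
  have h₂ := suppFun_le_add hT hne 0 x
  rw [abs_le]
  simp only [h0, sub_zero, zero_sub, norm_neg] at h₁ h₂
  constructor <;> linarith

lemma suppFun_mono {S : Set (E n)} (hST : S ⊆ T) (hS : S.Nonempty)
    (hT : T ⊆ Metric.closedBall μ r) (x : E n) : suppFun S μ x ≤ suppFun T μ x :=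
  suppFun_le hS fun _ ht => inner_le_suppFun hT x (hST ht)

lemma memLp_norm_stdGaussian : MemLp (fun x : E n => ‖x‖) 2 (stdGaussian (E n)) :=
  (IsGaussian.memLp_two_id (μ := stdGaussian (E n))).norm

lemma memLp_suppFun (hT : T ⊆ Metric.closedBall μ r) (hne : T.Nonempty) :
    MemLp (suppFun T μ) 2 (stdGaussian (E n)) := by
  refine (memLp_norm_stdGaussian.const_mul r).mono'
    (continuous_suppFun hT hne).aestronglyMeasurable (.of_forall fun x => ?_)
  exact abs_suppFun_le hT hne x

lemma integrable_suppFun (hT : T ⊆ Metric.closedBall μ r) (hne : T.Nonempty) :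
    Integrable (suppFun T μ) (stdGaussian (E n)) :=
  (memLp_suppFun hT hne).integrable one_le_two

lemma integral_inner_stdGaussian (v : E n) : ∫ x, inner ℝ x v ∂(stdGaussian (E n)) = 0 := by
  simpa [real_inner_comm] using integral_strongDual_stdGaussian (innerSL ℝ v)

lemma integrable_inner_stdGaussian (v : E n) :
    Integrable (fun x => inner ℝ x v) (stdGaussian (E n)) := by
  have := (IsGaussian.integrable_id (μ := stdGaussian (E n)))
  simpa [real_inner_comm] using (innerSL ℝ v).integrable_comp this

/-- Since `⟨x, μ⟩` has mean zero, centring does not change the width, and it makes the integrand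
`r`-Lipschitz. -/
lemma gaussianWidth_eq_integral_suppFun (hT : T ⊆ Metric.closedBall μ r) (hne : T.Nonempty) :
    gaussianWidth T = ∫ x, suppFun T μ x ∂(stdGaussian (E n)) := by
  have h (x : E n) : sSup ((fun t => inner ℝ x t) '' T) = suppFun T μ x + inner ℝ x μ := by
    have hb (t : E n) (ht : t ∈ T) : inner ℝ x t ≤ suppFun T μ x + inner ℝ x μ := by
      have := inner_le_suppFun hT x ht
      rw [inner_sub_right] at this
      linarith
    refine le_antisymm (csSup_le (hne.image _) ?_) ?_
    · rintro _ ⟨t, ht, rfl⟩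
      exact hb t ht
    · rw [← le_sub_iff_add_le]
      refine suppFun_le hne fun t ht => ?_
      rw [inner_sub_right]
      gcongr
      refine le_csSup ⟨suppFun T μ x + inner ℝ x μ, ?_⟩ ⟨t, ht, rfl⟩
      rintro _ ⟨t, ht, rfl⟩
      exact hb t ht
  simp only [gaussianWidth, h]
  rw [integral_add (integrable_suppFun hT hne) (integrable_inner_stdGaussian μ),
    integral_inner_stdGaussian, add_zero]

/-- A smoothing of `suppFun T μ`: the value `sup_{t ∈ T} (⟨x, t - μ⟩ - l ‖t - μ‖² / 2)`, attained
at the projection of `μ + x / l` on `T`. -/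
noncomputable def smoothSupp (T : Set (E n)) (μ : E n) (l : ℝ) (x : E n) : ℝ :=
  inner ℝ x (lse T (μ + l⁻¹ • x) - μ) - l / 2 * ‖lse T (μ + l⁻¹ • x) - μ‖ ^ 2

variable {l : ℝ}

/-- Completing the square turns the penalised maximisation into the projection of `μ + x / l`; the
variational inequality gives optimality. -/
lemma le_smoothSupp (hK : IsCompact T) (hc : Convex ℝ T) (hne : T.Nonempty) (hl : 0 < l)
    (x : E n) {t : E n} (ht : t ∈ T) :
    inner ℝ x (t - μ) - l / 2 * ‖t - μ‖ ^ 2 ≤ smoothSupp T μ l x := by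
  have h := lse_inner_le hK hc hne (μ + l⁻¹ • x) ht
  unfold smoothSupp
  set p := lse T (μ + l⁻¹ • x)
  have e₁ : μ + l⁻¹ • x - p = l⁻¹ • x - (p - μ) := by abel
  have e₂ : t - p = (t - μ) - (p - μ) := by abel
  rw [e₁, e₂] at h
  generalize p - μ = a at h ⊢
  generalize t - μ = b at h ⊢
  have h' : inner ℝ x (b - a) ≤ l * inner ℝ a (b - a) := by
    rw [inner_sub_left, real_inner_smul_left] at h
    have h2 := mul_le_mul_of_nonneg_left h hl.le
    rw [mul_sub, ← mul_assoc, mul_inv_cancel₀ hl.ne', one_mul, mul_zero] at h2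
    linarith
  have h'' := norm_sub_sq_real b a
  rw [inner_sub_right, inner_sub_right, real_inner_self_eq_norm_sq, real_inner_comm b a] at h'
  nlinarith [sq_nonneg ‖b - a‖]

lemma suppFun_le_smoothSupp (hK : IsCompact T) (hc : Convex ℝ T) (hne : T.Nonempty) (hl : 0 < l)
    (hr : T ⊆ Metric.closedBall μ r) (x : E n) :
    suppFun T μ x ≤ smoothSupp T μ l x + l / 2 * r ^ 2 := by
  refine suppFun_le hne fun t ht => ?_
  have h := le_smoothSupp (μ := μ) hK hc hne hl x ht
  have h2 := mem_closedBall_iff_norm.1 (hr ht)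
  have : l / 2 * ‖t - μ‖ ^ 2 ≤ l / 2 * r ^ 2 := by gcongr
  linarith

lemma smoothSupp_le_suppFun (hK : IsCompact T) (hne : T.Nonempty) (hl : 0 < l)
    (hr : T ⊆ Metric.closedBall μ r) (x : E n) :
    smoothSupp T μ l x ≤ suppFun T μ x := by
  have h := inner_le_suppFun hr x (lse_mem hK hne (μ + l⁻¹ • x))
  have : 0 ≤ l / 2 * ‖lse T (μ + l⁻¹ • x) - μ‖ ^ 2 := by positivity
  unfold smoothSupp
  linarith

/-- Envelope argument. Testing the supremum at `y` with the maximiser of `x`, and conversely, puts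
the first-order remainder between `0` and `⟨y - x, q - p⟩`, which is at most `‖y - x‖² / l` because
projections are nonexpansive. -/
lemma hasFDerivAt_smoothSupp (hK : IsCompact T) (hc : Convex ℝ T) (hne : T.Nonempty) (hl : 0 < l)
    (x : E n) :
    HasFDerivAt (smoothSupp T μ l) (innerSL ℝ (lse T (μ + l⁻¹ • x) - μ)) x := by
  rw [hasFDerivAt_iff_isLittleO]
  have hO : (fun y => smoothSupp T μ l y - smoothSupp T μ l x -
      (innerSL ℝ (lse T (μ + l⁻¹ • x) - μ)) (y - x)) =O[nhds x] fun y => ‖y - x‖ ^ 2 := by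
    refine Asymptotics.IsBigO.of_bound l⁻¹ (.of_forall fun y => ?_)
    have h₁ := le_smoothSupp (μ := μ) hK hc hne hl y (lse_mem hK hne (μ + l⁻¹ • x))
    have h₂ := le_smoothSupp (μ := μ) hK hc hne hl x (lse_mem hK hne (μ + l⁻¹ • y))
    have e₁ : smoothSupp T μ l x = inner ℝ x (lse T (μ + l⁻¹ • x) - μ)
      - l / 2 * ‖lse T (μ + l⁻¹ • x) - μ‖ ^ 2 := rfl
    have e₂ : smoothSupp T μ l y = inner ℝ y (lse T (μ + l⁻¹ • y) - μ)
      - l / 2 * ‖lse T (μ + l⁻¹ • y) - μ‖ ^ 2 := rfl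
    have h₃ := norm_lse_sub_lse_le hK hc hne (μ + l⁻¹ • y) (μ + l⁻¹ • x)
    have e₃ : μ + l⁻¹ • y - (μ + l⁻¹ • x) = l⁻¹ • (y - x) := by rw [smul_sub]; abel
    rw [e₃, norm_smul, Real.norm_of_nonneg (inv_nonneg.2 hl.le)] at h₃
    have h₄ := real_inner_le_norm (y - x) (lse T (μ + l⁻¹ • y) - lse T (μ + l⁻¹ • x))
    set p := lse T (μ + l⁻¹ • x)
    set q := lse T (μ + l⁻¹ • y)
    have h₅ : ‖y - x‖ * ‖q - p‖ ≤ ‖y - x‖ * (l⁻¹ * ‖y - x‖) := by gcongr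
    have e₄ : innerSL ℝ (p - μ) (y - x) = inner ℝ (y - x) (p - μ) := by
      rw [innerSL_apply_apply, real_inner_comm]
    have e₅ : inner ℝ (y - x) (q - p) = inner ℝ (y - x) (q - μ) - inner ℝ (y - x) (p - μ) := by
      rw [← inner_sub_right]; congr 1; abel
    rw [e₄, Real.norm_eq_abs, Real.norm_of_nonneg (by positivity), abs_le]
    rw [e₅] at h₄
    rw [inner_sub_left, inner_sub_left] at *
    have e₆ : ‖y - x‖ * (l⁻¹ * ‖y - x‖) = l⁻¹ * ‖y - x‖ ^ 2 := by ring
    have : 0 ≤ l⁻¹ * ‖y - x‖ ^ 2 := by positivity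
    constructor <;> linarith
  exact hO.trans_isLittleO <| by
    simpa using (Asymptotics.isLittleO_pow_sub_sub x one_lt_two).norm_left

end SupportFunction

/-! ### Gaussian Poincaré inequality and variance of the local supremum. -/

section Poincare

variable {n : ℕ}

/-- Cauchy-Schwarz, read off from the nonnegativity of the variance of `ψ` on `[0, b]`. -/
lemma sq_intervalIntegral_le {ψ : ℝ → ℝ} (hψ : Continuous ψ) {b : ℝ} (hb : 0 < b) :
    (∫ θ in (0 : ℝ)..b, ψ θ) ^ 2 ≤ b * ∫ θ in (0 : ℝ)..b, ψ θ ^ 2 := by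
  set I := ∫ θ in (0 : ℝ)..b, ψ θ with hI
  have h₁ : 0 ≤ ∫ θ in (0 : ℝ)..b, (ψ θ - I / b) ^ 2 :=
    intervalIntegral.integral_nonneg hb.le fun _ _ => sq_nonneg _
  have h₂ : ∫ θ in (0 : ℝ)..b, (ψ θ - I / b) ^ 2 =
      (∫ θ in (0 : ℝ)..b, ψ θ ^ 2) - 2 * (I / b) * I + b * (I / b) ^ 2 := by
    have e : ∀ θ, (ψ θ - I / b) ^ 2 = ψ θ ^ 2 - 2 * (I / b) * ψ θ + (I / b) ^ 2 := fun θ => by ring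
    simp only [e]
    rw [intervalIntegral.integral_add, intervalIntegral.integral_sub,
      intervalIntegral.integral_const_mul, intervalIntegral.integral_const, ← hI]
    · simp
    all_goals exact Continuous.intervalIntegrable (by fun_prop) _ _
  rw [h₂] at h₁
  have h₃ := mul_nonneg hb.le h₁
  have h₄ : b * ((∫ θ in (0 : ℝ)..b, ψ θ ^ 2) - 2 * (I / b) * I + b * (I / b) ^ 2) =
      b * (∫ θ in (0 : ℝ)..b, ψ θ ^ 2) - I ^ 2 := by
    field_simp
    ring
  linarith

lemma integrable_norm_sq_stdGaussian :
    Integrable (fun x : E n => ‖x‖ ^ 2) (stdGaussian (E n)) :=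
  memLp_norm_stdGaussian.integrable_sq

lemma integral_inner_sq_stdGaussian (v : E n) :
    ∫ x, inner ℝ v x ^ 2 ∂(stdGaussian (E n)) = ‖v‖ ^ 2 := by
  have h := variance_dual_stdGaussian (innerSL ℝ v)
  rw [variance_eq_integral (by fun_prop), integral_strongDual_stdGaussian] at h
  simpa using h

lemma stdGaussian_prod_map_rotation (θ : ℝ) :
    ((stdGaussian (E n)).prod (stdGaussian (E n))).map (ContinuousLinearMap.rotation θ) =
      (stdGaussian (E n)).prod (stdGaussian (E n)) :=
  IsGaussian.map_rotation_eq_self (by simp) θ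

lemma hasDerivAt_comp_rotation {f : E n → ℝ} {G : E n → E n}
    (hf : ∀ x, HasFDerivAt f (innerSL ℝ (G x)) x) (z : E n × E n) (θ : ℝ) :
    HasDerivAt (fun θ => f (ContinuousLinearMap.rotation θ z).1)
      (inner ℝ (G (ContinuousLinearMap.rotation θ z).1) (ContinuousLinearMap.rotation θ z).2) θ := by
  simp only [ContinuousLinearMap.rotation_apply]
  have h : HasDerivAt (fun θ => Real.cos θ • z.1 + Real.sin θ • z.2)
      (-Real.sin θ • z.1 + Real.cos θ • z.2) θ :=
    ((Real.hasDerivAt_cos θ).smul_const z.1).add ((Real.hasDerivAt_sin θ).smul_const z.2)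
  exact (hf (Real.cos θ • z.1 + Real.sin θ • z.2)).comp_hasDerivAt θ h

/-- The derivative of `f` along the rotation flow, when `G` is the gradient of `f`. -/
noncomputable def rotInner (G : E n → E n) (z : E n × E n) (θ : ℝ) : ℝ :=
  inner ℝ (G (ContinuousLinearMap.rotation θ z).1) (ContinuousLinearMap.rotation θ z).2

lemma continuous_uncurry_rotInner {G : E n → E n} (hG : Continuous G) :
    Continuous (Function.uncurry (rotInner G)) := by
  unfold rotInner Function.uncurry
  simp only [ContinuousLinearMap.rotation_apply]
  fun_prop

lemma continuous_rotInner {G : E n → E n} (hG : Continuous G) (z : E n × E n) :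
    Continuous (rotInner G z) := by
  unfold rotInner
  simp only [ContinuousLinearMap.rotation_apply]
  fun_prop

lemma rotInner_sq_le {G : E n → E n} {r : ℝ} (hr : ∀ x, ‖G x‖ ≤ r) (z : E n × E n) (θ : ℝ) :
    rotInner G z θ ^ 2 ≤ r ^ 2 * (2 * ‖z.1‖ ^ 2 + 2 * ‖z.2‖ ^ 2) := by
  have hr0 : 0 ≤ r := (norm_nonneg _).trans (hr 0)
  have h₁ : |rotInner G z θ| ≤ r * (‖z.1‖ + ‖z.2‖) := by
    refine (abs_real_inner_le_norm _ _).trans (mul_le_mul (hr _) ?_ (norm_nonneg _) hr0)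
    rw [ContinuousLinearMap.rotation_apply]
    refine (norm_add_le _ _).trans (add_le_add ?_ ?_)
    · rw [norm_smul, norm_neg]
      exact mul_le_of_le_one_left (norm_nonneg _) (Real.abs_sin_le_one θ)
    · rw [norm_smul]
      exact mul_le_of_le_one_left (norm_nonneg _) (Real.abs_cos_le_one θ)
  calc rotInner G z θ ^ 2 = |rotInner G z θ| ^ 2 := (sq_abs _).symm
    _ ≤ (r * (‖z.1‖ + ‖z.2‖)) ^ 2 := by gcongr
    _ = r ^ 2 * (‖z.1‖ + ‖z.2‖) ^ 2 := by ring
    _ ≤ _ := by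
      gcongr
      nlinarith [sq_nonneg (‖z.1‖ - ‖z.2‖)]

lemma integrable_norm_sq_prod (r : ℝ) :
    Integrable (fun z : E n × E n => r ^ 2 * (2 * ‖z.1‖ ^ 2 + 2 * ‖z.2‖ ^ 2))
      ((stdGaussian (E n)).prod (stdGaussian (E n))) := by
  have h₁ : Integrable (fun z : E n × E n => ‖z.1‖ ^ 2)
      ((stdGaussian (E n)).prod (stdGaussian (E n))) :=
    integrable_norm_sq_stdGaussian.comp_fst _
  have h₂ : Integrable (fun z : E n × E n => ‖z.2‖ ^ 2)
      ((stdGaussian (E n)).prod (stdGaussian (E n))) :=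
    integrable_norm_sq_stdGaussian.comp_snd _
  exact ((h₁.const_mul 2).add (h₂.const_mul 2)).const_mul _

/-- The first coordinate of the rotated pair moves from `z.1` at angle `0` to `z.2` at angle `π /
2`, with velocity equal to the second coordinate. -/
lemma sq_sub_le_integral_rotInner {f : E n → ℝ} {G : E n → E n}
    (hf : ∀ x, HasFDerivAt f (innerSL ℝ (G x)) x) (hG : Continuous G) (z : E n × E n) :
    (f z.1 - f z.2) ^ 2 ≤ Real.pi / 2 * ∫ θ in (0 : ℝ)..Real.pi / 2, rotInner G z θ ^ 2 := by
  have h := intervalIntegral.integral_eq_sub_of_hasDerivAt (a := 0) (b := Real.pi / 2)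
    (f' := rotInner G z) (fun θ _ => hasDerivAt_comp_rotation hf z θ)
    ((continuous_rotInner hG z).intervalIntegrable _ _)
  have h' : f z.2 - f z.1 = ∫ θ in (0 : ℝ)..Real.pi / 2, rotInner G z θ := by
    rw [h]
    simp [ContinuousLinearMap.rotation_apply]
  rw [← neg_sub, neg_sq, h']
  exact sq_intervalIntegral_le (continuous_rotInner hG z) (by positivity)

/-- Rotation invariance removes the angle. The two coordinates are then independent, and given `z.1`
the inner product has second moment `‖G z.1‖²`. -/
lemma integral_rotInner_sq_le {G : E n → E n} {r : ℝ} (hG : Continuous G) (hr : ∀ x, ‖G x‖ ≤ r)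
    (θ : ℝ) :
    ∫ z, rotInner G z θ ^ 2 ∂((stdGaussian (E n)).prod (stdGaussian (E n))) ≤ r ^ 2 := by
  have e : ∫ z, rotInner G z θ ^ 2 ∂((stdGaussian (E n)).prod (stdGaussian (E n))) =
      ∫ z, inner ℝ (G z.1) z.2 ^ 2 ∂((stdGaussian (E n)).prod (stdGaussian (E n))) := by
    conv_rhs => rw [← stdGaussian_prod_map_rotation θ]
    have hm : AEStronglyMeasurable (fun z : E n × E n => inner ℝ (G z.1) z.2 ^ 2)
        (((stdGaussian (E n)).prod (stdGaussian (E n))).map (ContinuousLinearMap.rotation θ)) :=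
      Continuous.aestronglyMeasurable (by fun_prop)
    rw [integral_map (by fun_prop) hm]
    rfl
  have hi : Integrable (fun z : E n × E n => inner ℝ (G z.1) z.2 ^ 2)
      ((stdGaussian (E n)).prod (stdGaussian (E n))) := by
    refine (integrable_norm_sq_prod r).mono' (Continuous.aestronglyMeasurable (by fun_prop))
      (.of_forall fun z => ?_)
    rw [Real.norm_of_nonneg (sq_nonneg _)]
    simpa [rotInner, ContinuousLinearMap.rotation_apply] using rotInner_sq_le hr z 0
  rw [e, integral_prod _ hi]
  simp only [integral_inner_sq_stdGaussian]
  calc ∫ x, ‖G x‖ ^ 2 ∂(stdGaussian (E n)) ≤ ∫ _, r ^ 2 ∂(stdGaussian (E n)) := by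
        refine integral_mono_of_nonneg (.of_forall fun _ => sq_nonneg _)
          (integrable_const _) (.of_forall fun x => ?_)
        have := hr x
        dsimp only
        gcongr
    _ = r ^ 2 := by simp

/-- Gaussian Poincaré inequality, in the form of Maurey and Pisier. -/
lemma integral_prod_sq_sub_le {f : E n → ℝ} {G : E n → E n} {r : ℝ}
    (hf : ∀ x, HasFDerivAt f (innerSL ℝ (G x)) x) (hG : Continuous G) (hr : ∀ x, ‖G x‖ ≤ r) :
    ∫ z, (f z.1 - f z.2) ^ 2 ∂((stdGaussian (E n)).prod (stdGaussian (E n))) ≤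
      (Real.pi / 2) ^ 2 * r ^ 2 := by
  have hpi : 0 < Real.pi / 2 := by positivity
  have hjoint : Integrable (Function.uncurry fun z θ => rotInner G z θ ^ 2)
      (((stdGaussian (E n)).prod (stdGaussian (E n))).prod
        (volume.restrict (Set.Ioc 0 (Real.pi / 2)))) := by
    refine ((integrable_norm_sq_prod r).comp_fst
      (volume.restrict (Set.Ioc 0 (Real.pi / 2)))).mono'
      ((continuous_uncurry_rotInner hG).pow 2).aestronglyMeasurable (.of_forall fun p => ?_)
    rw [Function.uncurry, Real.norm_of_nonneg (sq_nonneg _)]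
    exact rotInner_sq_le hr p.1 p.2
  have hpt := sq_sub_le_integral_rotInner hf hG
  simp only [intervalIntegral.integral_of_le hpi.le] at hpt
  have hint := hjoint.integral_prod_left
  have hswap := integral_integral_swap hjoint
  have hlast : ∫ θ in Set.Ioc 0 (Real.pi / 2),
      ∫ z, rotInner G z θ ^ 2 ∂((stdGaussian (E n)).prod (stdGaussian (E n))) ≤
      ∫ _ in Set.Ioc 0 (Real.pi / 2), r ^ 2 :=
    integral_mono hjoint.integral_prod_right (integrable_const _)
      (integral_rotInner_sq_le hG hr)
  have hconst : ∫ _ in Set.Ioc 0 (Real.pi / 2), r ^ 2 = Real.pi / 2 * r ^ 2 := by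
    simp [hpi.le]
  have hmono := integral_mono_of_nonneg (.of_forall fun _ => sq_nonneg _) (hint.const_mul _)
    (.of_forall hpt)
  refine hmono.trans ?_
  rw [integral_const_mul]
  dsimp only [Function.uncurry] at hswap ⊢
  rw [hswap, pow_two (Real.pi / 2), mul_assoc]
  rw [hconst] at hlast
  gcongr

lemma integral_sq_sub_integral_le {Ω : Type*} [MeasurableSpace Ω] {P : Measure Ω}
    [IsProbabilityMeasure P] {g : Ω → ℝ} (hg : MemLp g 2 P) :
    2 * ∫ x, (g x - ∫ y, g y ∂P) ^ 2 ∂P = ∫ z, (g z.1 - g z.2) ^ 2 ∂(P.prod P) := by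
  have hg1 := hg.integrable one_le_two
  have hg2 := hg.integrable_sq
  have hp : Integrable (fun z : Ω × Ω => g z.1 * g z.2) (P.prod P) := hg1.mul_prod hg1
  have e : ∀ z : Ω × Ω, (g z.1 - g z.2) ^ 2 = g z.1 ^ 2 - 2 * (g z.1 * g z.2) + g z.2 ^ 2 :=
    fun z => by ring
  simp only [e]
  have h₁ : Integrable (fun z : Ω × Ω => g z.1 ^ 2) (P.prod P) := hg2.comp_fst P
  have h₂ : Integrable (fun z : Ω × Ω => g z.2 ^ 2) (P.prod P) := hg2.comp_snd P
  have h₃ : Integrable (fun z : Ω × Ω => g z.1 ^ 2 - 2 * (g z.1 * g z.2)) (P.prod P) :=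
    h₁.sub (hp.const_mul 2)
  rw [integral_add h₃ h₂, integral_sub h₁ (hp.const_mul 2), integral_const_mul,
    integral_prod_mul, integral_fun_fst (fun x => g x ^ 2), integral_fun_snd (fun x => g x ^ 2)]
  set m := ∫ y, g y ∂P with hm
  have e' : ∀ x, (g x - m) ^ 2 = g x ^ 2 - 2 * m * g x + m ^ 2 := fun x => by ring
  simp only [e']
  have h₄ : Integrable (fun x => g x ^ 2 - 2 * m * g x) P := hg2.sub (hg1.const_mul _)
  rw [integral_add h₄ (integrable_const _),
    integral_sub hg2 (hg1.const_mul _), integral_const_mul, ← hm]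
  simp
  ring

/-- The variance of the supremum of a Gaussian process indexed by a convex body of radius `r`. -/
lemma integral_sq_suppFun_sub_le {T : Set (E n)} {μ : E n} {r : ℝ} (hr : 0 < r)
    (hK : IsCompact T) (hc : Convex ℝ T) (hne : T.Nonempty) (hT : T ⊆ Metric.closedBall μ r) :
    ∫ x, (suppFun T μ x - gaussianWidth T) ^ 2 ∂(stdGaussian (E n)) ≤ 6 * r ^ 2 := by
  rw [gaussianWidth_eq_integral_suppFun hT hne]
  -- The smoothing parameter `1 / r` keeps the gradient bounded by `r` and the uniform error below
  -- `r / 2`. With `(π / 2)² ≤ 4`, twice the variance is at most `2 · 4r² + 2r²`.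
  have hl : 0 < r⁻¹ := inv_pos.2 hr
  have h := integral_sq_sub_integral_le (memLp_suppFun hT hne)
  set γ := stdGaussian (E n)
  set f := smoothSupp T μ r⁻¹
  have hf := fun x => hasFDerivAt_smoothSupp (μ := μ) hK hc hne hl x
  have hG : Continuous fun x => lse T (μ + r⁻¹⁻¹ • x) - μ := by
    have := continuous_lse hK hc hne
    fun_prop
  have hb (x : E n) : ‖lse T (μ + r⁻¹⁻¹ • x) - μ‖ ≤ r :=
    mem_closedBall_iff_norm.1 (hT (lse_mem hK hne _))
  have hP := integral_prod_sq_sub_le hf hG hb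
  have hfc : Continuous f := continuous_iff_continuousAt.2 fun x => (hf x).continuousAt
  have hd (x : E n) : |suppFun T μ x - f x| ≤ r / 2 := by
    have h₁ := suppFun_le_smoothSupp hK hc hne hl hT x
    have h₂ := smoothSupp_le_suppFun hK hne hl hT x
    have e : r⁻¹ / 2 * r ^ 2 = r / 2 := by field_simp
    rw [e] at h₁
    rw [abs_le]
    constructor <;> linarith
  have hfL : MemLp f 2 γ := by
    have : MemLp (fun x => suppFun T μ x - f x) 2 γ :=
      MemLp.of_bound (by have := continuous_suppFun hT hne; fun_prop) (r / 2) (.of_forall hd)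
    have h' := (memLp_suppFun hT hne).sub this
    rwa [show (suppFun T μ - fun x => suppFun T μ x - f x) = f from
      funext fun x => sub_sub_cancel _ _] at h'
  have hfi : Integrable (fun z : E n × E n => (f z.1 - f z.2) ^ 2) (γ.prod γ) :=
    ((hfL.comp_fst γ).sub (hfL.comp_snd γ)).integrable_sq
  have hle : ∫ z, (suppFun T μ z.1 - suppFun T μ z.2) ^ 2 ∂(γ.prod γ) ≤
      ∫ z, (2 * (f z.1 - f z.2) ^ 2 + 2 * r ^ 2) ∂(γ.prod γ) := by
    refine integral_mono_of_nonneg (.of_forall fun _ => sq_nonneg _)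
      ((hfi.const_mul 2).add (integrable_const _)) (.of_forall fun z => ?_)
    have h₁ := abs_le.1 (hd z.1)
    have h₂ := abs_le.1 (hd z.2)
    dsimp only
    generalize suppFun T μ z.1 = a at *
    generalize suppFun T μ z.2 = b at *
    have h₃ : ((a - b) - (f z.1 - f z.2)) ^ 2 ≤ r ^ 2 := sq_le_sq' (by linarith) (by linarith)
    nlinarith [sq_nonneg ((a - b) - 2 * (f z.1 - f z.2))]
  rw [integral_add (hfi.const_mul 2) (integrable_const _), integral_const_mul] at hle
  simp only [integral_const, probReal_univ, one_smul] at hle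
  have hpi : (Real.pi / 2) ^ 2 ≤ 4 := by
    have := Real.pi_le_four
    have := Real.pi_pos
    nlinarith
  nlinarith [sq_nonneg r]

end Poincare

/-! ### Exponential moments and translations of the Gaussian. -/

section CameronMartin

open Complex in
-- The integrand factors over coordinates. Keeping a real and an imaginary part together gives both
-- the exponential moments (`t = 0`) and the characteristic function of the tilted measure.
lemma integral_cexp_stdGaussian {n : ℕ} (h t : E n) :
    ∫ x, cexp ((inner ℝ x h : ℝ) + (inner ℝ x t : ℝ) * I) ∂(stdGaussian (E n)) =
      cexp (‖h‖ ^ 2 / 2 + (inner ℝ h t : ℝ) * I - ‖t‖ ^ 2 / 2) := by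
  rw [← map_pi_eq_stdGaussian, integral_map (Measurable.aemeasurable (by fun_prop))
    (Continuous.aestronglyMeasurable (by fun_prop))]
  have e (x : Fin n → ℝ) : cexp ((inner ℝ (WithLp.toLp 2 x) h : ℝ) +
      (inner ℝ (WithLp.toLp 2 x) t : ℝ) * I) = ∏ i, cexp (((h i : ℂ) + t i * I) * (x i : ℝ)) := by
    rw [← exp_sum]
    congr 1
    simp only [PiLp.inner_apply, Real.inner_apply, ofReal_sum, Finset.sum_mul,
      ← Finset.sum_add_distrib, ofReal_mul]
    exact Finset.sum_congr rfl fun i _ => by ring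
  simp only [e]
  rw [integral_fintype_prod_eq_prod (f := fun i (x : ℝ) => cexp (((h i : ℂ) + t i * I) * x))]
  have e' (i : Fin n) : ∫ x : ℝ, cexp (((h i : ℂ) + t i * I) * x) ∂(gaussianReal 0 1) =
      cexp (((h i : ℂ) + t i * I) ^ 2 / 2) := by
    have := complexMGF_id_gaussianReal (μ := 0) (v := 1) ((h i : ℂ) + t i * I)
    simpa [complexMGF] using this
  simp only [e']
  rw [← exp_sum]
  congr 1
  have n1 : ((‖h‖ ^ 2 : ℝ) : ℂ) = ∑ i, (h i : ℂ) ^ 2 := by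
    rw [EuclideanSpace.real_norm_sq_eq]; push_cast; rfl
  have n2 : ((‖t‖ ^ 2 : ℝ) : ℂ) = ∑ i, (t i : ℂ) ^ 2 := by
    rw [EuclideanSpace.real_norm_sq_eq]; push_cast; rfl
  push_cast at n1 n2
  rw [n1, n2]
  simp only [PiLp.inner_apply, Real.inner_apply, ofReal_sum, Finset.sum_mul, Finset.sum_div,
    ← Finset.sum_add_distrib, ← Finset.sum_sub_distrib, ofReal_mul]
  refine Finset.sum_congr rfl fun i _ => ?_
  linear_combination ((t i : ℂ) ^ 2 / 2) * I_sq

variable {n : ℕ}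

lemma integrable_exp_inner (h : E n) :
    Integrable (fun x => Real.exp (inner ℝ x h)) (stdGaussian (E n)) := by
  have hi := integral_cexp_stdGaussian h 0
  have : Integrable (fun x => Complex.exp ((inner ℝ x h : ℝ) + (inner ℝ x (0 : E n) : ℝ) *
      Complex.I)) (stdGaussian (E n)) := by
    -- A non-integrable function has integral `0` by convention, but the computed value is an
    -- exponential.
    by_contra hn
    rw [integral_undef hn] at hi
    exact (Complex.exp_ne_zero _ hi.symm).elim
  simpa [Complex.norm_exp] using this.norm

lemma integral_exp_inner (h : E n) :
    ∫ x, Real.exp (inner ℝ x h) ∂(stdGaussian (E n)) = Real.exp (‖h‖ ^ 2 / 2) := by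
  have hi := integral_cexp_stdGaussian h 0
  simp only [inner_zero_right, Complex.ofReal_zero, zero_mul, add_zero, norm_zero,
    ← Complex.ofReal_exp, integral_complex_ofReal] at hi
  apply Complex.ofReal_injective
  rw [hi]
  push_cast
  simp

/-- The density of the standard Gaussian translated by `h`, relative to the standard Gaussian. -/
noncomputable def shiftDensity (h x : E n) : ℝ := Real.exp (inner ℝ x h - ‖h‖ ^ 2 / 2)

lemma shiftDensity_nonneg (h x : E n) : 0 ≤ shiftDensity h x := Real.exp_nonneg _

lemma shiftDensity_eq (h x : E n) :
    shiftDensity h x = Real.exp (-(‖h‖ ^ 2 / 2)) * Real.exp (inner ℝ x h) := by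
  rw [shiftDensity, ← Real.exp_add]
  ring_nf

lemma integrable_shiftDensity (h : E n) : Integrable (shiftDensity h) (stdGaussian (E n)) := by
  rw [funext (shiftDensity_eq h)]
  exact (integrable_exp_inner h).const_mul _

lemma integral_shiftDensity (h : E n) : ∫ x, shiftDensity h x ∂(stdGaussian (E n)) = 1 := by
  simp only [shiftDensity_eq, integral_const_mul, integral_exp_inner]
  rw [← Real.exp_add, neg_add_cancel, Real.exp_zero]

lemma shiftDensity_sq (h x : E n) :
    shiftDensity h x ^ 2 = Real.exp (‖h‖ ^ 2) * shiftDensity ((2 : ℝ) • h) x := by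
  simp only [shiftDensity, ← Real.exp_add, ← Real.exp_nat_mul, norm_smul, inner_smul_right]
  congr 1
  norm_num
  ring

lemma integrable_shiftDensity_sq (h : E n) :
    Integrable (fun x => shiftDensity h x ^ 2) (stdGaussian (E n)) := by
  simpa only [shiftDensity_sq] using (integrable_shiftDensity _).const_mul _

/-- The chi-square divergence of a translate; the square of the density for `h` is a multiple of the
density for `2h`. -/
lemma integral_shiftDensity_sub_one_sq (h : E n) :
    ∫ x, (shiftDensity h x - 1) ^ 2 ∂(stdGaussian (E n)) = Real.exp (‖h‖ ^ 2) - 1 := by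
  have e : ∀ x, (shiftDensity h x - 1) ^ 2 = shiftDensity h x ^ 2 - 2 * shiftDensity h x + 1 :=
    fun x => by ring
  simp only [e]
  have h₁ : Integrable (fun x => shiftDensity h x ^ 2 - 2 * shiftDensity h x)
      (stdGaussian (E n)) :=
    (integrable_shiftDensity_sq h).sub ((integrable_shiftDensity h).const_mul 2)
  rw [integral_add h₁ (integrable_const _),
    integral_sub (integrable_shiftDensity_sq h) ((integrable_shiftDensity h).const_mul 2),
    integral_const_mul, integral_shiftDensity]
  simp only [shiftDensity_sq, integral_const_mul, integral_shiftDensity]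
  simp
  ring

lemma continuous_shiftDensity (h : E n) : Continuous (shiftDensity h) := by
  unfold shiftDensity
  fun_prop

lemma memLp_shiftDensity (h : E n) : MemLp (shiftDensity h) 2 (stdGaussian (E n)) :=
  (memLp_two_iff_integrable_sq (continuous_shiftDensity h).aestronglyMeasurable).2
    (integrable_shiftDensity_sq h)

/-- The Cameron-Martin formula, as an equality of measures. -/
lemma stdGaussian_map_add_right (h : E n) :
    (stdGaussian (E n)).map (fun x => x + h) =
      (stdGaussian (E n)).withDensity (fun x => ENNReal.ofReal (shiftDensity h x)) := by
  have hm := (continuous_shiftDensity h).measurable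
  have : IsProbabilityMeasure ((stdGaussian (E n)).map (fun x => x + h)) :=
    Measure.isProbabilityMeasure_map (by fun_prop)
  have : IsFiniteMeasure ((stdGaussian (E n)).withDensity
      (fun x => ENNReal.ofReal (shiftDensity h x))) :=
    isFiniteMeasure_withDensity_ofReal (integrable_shiftDensity h).2
  refine Measure.ext_of_charFun ?_
  ext t
  rw [charFun_apply, charFun_apply, integral_map (by fun_prop)
    (Continuous.aestronglyMeasurable (by fun_prop)),
    integral_withDensity_eq_integral_toReal_smul (by fun_prop) (by simp)]
  have h₁ (x : E n) : Complex.exp ((inner ℝ (x + h) t : ℝ) * Complex.I) =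
      Complex.exp ((inner ℝ h t : ℝ) * Complex.I) *
        Complex.exp ((inner ℝ x (0 : E n) : ℝ) + (inner ℝ x t : ℝ) * Complex.I) := by
    rw [← Complex.exp_add, inner_add_left]
    simp
    ring_nf
  have h₂ (x : E n) : (ENNReal.ofReal (shiftDensity h x)).toReal •
      Complex.exp ((inner ℝ x t : ℝ) * Complex.I) =
      Complex.exp (-(‖h‖ ^ 2 / 2)) *
        Complex.exp ((inner ℝ x h : ℝ) + (inner ℝ x t : ℝ) * Complex.I) := by
    rw [ENNReal.toReal_ofReal (shiftDensity_nonneg h x), shiftDensity, Complex.real_smul,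
      Complex.ofReal_exp, ← Complex.exp_add, ← Complex.exp_add]
    congr 1
    push_cast
    ring
  simp only [h₁, h₂, integral_const_mul, integral_cexp_stdGaussian]
  rw [← Complex.exp_add, ← Complex.exp_add]
  congr 1
  simp
  ring

lemma integral_add_right_stdGaussian (h : E n) (g : E n → ℝ) :
    ∫ x, g (x + h) ∂(stdGaussian (E n)) = ∫ x, shiftDensity h x * g x ∂(stdGaussian (E n)) := by
  have hm := (continuous_shiftDensity h).measurable
  have h₁ := (Homeomorph.addRight h).measurableEmbedding.integral_map
    (μ := stdGaussian (E n)) g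
  simp only [Homeomorph.coe_addRight] at h₁
  rw [← h₁, stdGaussian_map_add_right,
    integral_withDensity_eq_integral_toReal_smul (by fun_prop) (by simp)]
  refine integral_congr_ae (.of_forall fun x => ?_)
  simp only [smul_eq_mul]
  rw [ENNReal.toReal_ofReal (shiftDensity_nonneg h x)]

end CameronMartin

/-! ### Elementary risk bounds and the two-point lower bound. -/

section Risk

variable {n : ℕ} {K : Set (E n)} {σ : ℝ}

lemma norm_lse_sub_le_diam (hK : IsCompact K) (hne : K.Nonempty) {μ : E n}
    (hμ : μ ∈ K) (y : E n) : ‖lse K y - μ‖ ≤ Metric.diam K := by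
  rw [← dist_eq_norm]
  exact Metric.dist_le_diam_of_mem hK.isBounded (lse_mem hK hne y) hμ

lemma continuous_lse_sub (hK : IsCompact K) (hc : Convex ℝ K) (hne : K.Nonempty) (σ : ℝ)
    (μ : E n) : Continuous fun z => lse K (μ + σ • z) - μ := by
  have := continuous_lse hK hc hne
  fun_prop

lemma memLp_norm_lse_sub (hK : IsCompact K) (hc : Convex ℝ K) (hne : K.Nonempty) (σ : ℝ) {μ : E n}
    (hμ : μ ∈ K) : MemLp (fun z => ‖lse K (μ + σ • z) - μ‖) 2 (stdGaussian (E n)) :=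
  MemLp.of_bound (continuous_lse_sub hK hc hne σ μ).norm.aestronglyMeasurable (Metric.diam K)
    (.of_forall fun z => by
      rw [norm_norm]
      exact norm_lse_sub_le_diam hK hne hμ _)

lemma integrable_norm_lse_sub_sq (hK : IsCompact K) (hc : Convex ℝ K) (hne : K.Nonempty) (σ : ℝ)
    {μ : E n} (hμ : μ ∈ K) :
    Integrable (fun z => ‖lse K (μ + σ • z) - μ‖ ^ 2) (stdGaussian (E n)) :=
  (memLp_norm_lse_sub hK hc hne σ hμ).integrable_sq

lemma lseRisk_nonneg (K : Set (E n)) (σ : ℝ) (μ : E n) : 0 ≤ lseRisk K σ μ :=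
  integral_nonneg fun _ => sq_nonneg _

lemma lseRisk_le_diam_sq (hK : IsCompact K) (hne : K.Nonempty) (σ : ℝ)
    {μ : E n} (hμ : μ ∈ K) : lseRisk K σ μ ≤ Metric.diam K ^ 2 := by
  calc lseRisk K σ μ ≤ ∫ _, Metric.diam K ^ 2 ∂(stdGaussian (E n)) := by
        refine integral_mono_of_nonneg (.of_forall fun _ => sq_nonneg _) (integrable_const _)
          (.of_forall fun z => ?_)
        have := norm_lse_sub_le_diam hK hne hμ (μ + σ • z)
        dsimp only
        gcongr
    _ = Metric.diam K ^ 2 := by simp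

lemma lseRisk_le_worstCaseRate_sq (hK : IsCompact K) (hne : K.Nonempty) (σ : ℝ)
    {μ : E n} (hμ : μ ∈ K) : lseRisk K σ μ ≤ worstCaseRate K σ ^ 2 := by
  have hb : lseRisk K σ μ ≤ sSup (lseRisk K σ '' K) := by
    refine le_csSup ⟨Metric.diam K ^ 2, ?_⟩ ⟨μ, hμ, rfl⟩
    rintro _ ⟨ν, hν, rfl⟩
    exact lseRisk_le_diam_sq hK hne σ hν
  rwa [worstCaseRate, Real.sq_sqrt ((lseRisk_nonneg K σ μ).trans hb)]

lemma worstCaseRate_nonneg (K : Set (E n)) (σ : ℝ) : 0 ≤ worstCaseRate K σ := Real.sqrt_nonneg _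

lemma worstCaseRate_le (hne : K.Nonempty) {b : ℝ} (hb : 0 ≤ b)
    (h : ∀ μ ∈ K, lseRisk K σ μ ≤ b ^ 2) : worstCaseRate K σ ≤ b := by
  refine Real.sqrt_le_iff.2 ⟨hb, csSup_le (hne.image _) ?_⟩
  rintro _ ⟨μ, hμ, rfl⟩
  exact h μ hμ

lemma worstCaseRate_le_diam (hK : IsCompact K) (hne : K.Nonempty) (σ : ℝ) :
    worstCaseRate K σ ≤ Metric.diam K :=
  worstCaseRate_le hne Metric.diam_nonneg fun _ hμ => lseRisk_le_diam_sq hK hne σ hμ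

/-- The two-point lower bound of Chapman and Robbins. -/
lemma norm_sub_le_mul_worstCaseRate (hK : IsCompact K) (hc : Convex ℝ K) (hσ : 0 < σ) {p q : E n}
    (hp : p ∈ K) (hq : q ∈ K) (hpq : ‖q - p‖ ≤ σ) : ‖q - p‖ ≤ 4 * worstCaseRate K σ := by
  have hne : K.Nonempty := ⟨p, hp⟩
  have hε := worstCaseRate_nonneg K σ
  rcases eq_or_lt_of_le (norm_nonneg (q - p)) with h0 | hm
  · rw [← h0]; positivity
  have hRp := lseRisk_le_worstCaseRate_sq hK hne σ hp
  have hRq := lseRisk_le_worstCaseRate_sq hK hne σ hq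
  set ε := worstCaseRate K σ
  set m := ‖q - p‖ with hmdef
  set h := σ⁻¹ • (q - p) with hh
  have hnh : ‖h‖ ≤ 1 := by
    rw [hh, norm_smul, Real.norm_of_nonneg (inv_nonneg.2 hσ.le), inv_mul_le_one₀ hσ]
    exact hpq
  have hexp : Real.exp (‖h‖ ^ 2) - 1 ≤ 2 := by
    have h₁ : Real.exp (‖h‖ ^ 2) ≤ Real.exp 1 :=
      Real.exp_le_exp.2 (pow_le_one₀ (norm_nonneg _) hnh)
    have := Real.exp_one_lt_d9
    linarith
  -- `f` and `g` are the components along `q - p` of the errors at `p` and at `q`. Both means would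
  -- have to be small if the risk were, but translating the noise by `h` shows that they are linked
  -- through a gap `m`.
  let f : E n → ℝ := fun x => m⁻¹ * inner ℝ (q - p) (lse K (p + σ • x) - p)
  let g : E n → ℝ := fun x => m⁻¹ * inner ℝ (q - p) (lse K (q + σ • x) - q)
  have hinner (v : E n) : |m⁻¹ * inner ℝ (q - p) v| ≤ ‖v‖ := by
    rw [abs_mul, abs_of_pos (inv_pos.2 hm), inv_mul_le_iff₀ hm]
    exact abs_real_inner_le_norm _ _
  have hfc : Continuous f := by
    have := continuous_lse_sub hK hc hne σ p
    fun_prop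
  have hgc : Continuous g := by
    have := continuous_lse_sub hK hc hne σ q
    fun_prop
  have hfL : MemLp f 2 (stdGaussian (E n)) :=
    (memLp_norm_lse_sub hK hc hne σ hp).mono' hfc.aestronglyMeasurable
      (.of_forall fun x => hinner _)
  have hgL : MemLp g 2 (stdGaussian (E n)) :=
    (memLp_norm_lse_sub hK hc hne σ hq).mono' hgc.aestronglyMeasurable
      (.of_forall fun x => hinner _)
  have hf2 : ∫ x, f x ^ 2 ∂(stdGaussian (E n)) ≤ ε ^ 2 :=
    (integral_mono hfL.integrable_sq (integrable_norm_lse_sub_sq hK hc hne σ hp)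
      fun x => sq_le_sq' (abs_le.1 (hinner _)).1 (abs_le.1 (hinner _)).2).trans hRp
  have hg2 : ∫ x, g x ^ 2 ∂(stdGaussian (E n)) ≤ ε ^ 2 :=
    (integral_mono hgL.integrable_sq (integrable_norm_lse_sub_sq hK hc hne σ hq)
      fun x => sq_le_sq' (abs_le.1 (hinner _)).1 (abs_le.1 (hinner _)).2).trans hRq
  have hshift (x : E n) : f (x + h) = m + g x := by
    have e₁ : p + σ • (x + h) = q + σ • x := by
      rw [hh, smul_add, smul_smul, mul_inv_cancel₀ hσ.ne', one_smul]
      abel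
    have e₂ : lse K (q + σ • x) - p = (q - p) + (lse K (q + σ • x) - q) := by abel
    simp only [f, g]
    rw [e₁, e₂, inner_add_right, real_inner_self_eq_norm_sq, mul_add, ← hmdef]
    congr 1
    field_simp
  have hCM := integral_add_right_stdGaussian h f
  simp only [hshift] at hCM
  have hgi := hgL.integrable one_le_two
  rw [integral_add (integrable_const _) hgi] at hCM
  simp only [integral_const, probReal_univ, one_smul] at hCM
  have hD := memLp_shiftDensity h
  have hD1 : MemLp (fun x => shiftDensity h x - 1) 2 (stdGaussian (E n)) :=
    hD.sub (memLp_const 1)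
  -- With `D` the density, split `D f = f + (D - 1) f` and use `f ≤ m/8 + 2f²/m` and `(D - 1) f ≤
  -- (m/16)(D - 1)² + 4f²/m`; the chi-square term is at most `2`.
  have hup : ∫ x, shiftDensity h x * f x ∂(stdGaussian (E n)) ≤
      m / 8 + 6 / m * ε ^ 2 + m / 8 := by
    have hi₁ := hfL.integrable_sq.const_mul (6 / m)
    have hi₂ := hD1.integrable_sq.const_mul (m / 16)
    have hi₃ : Integrable (fun x => m / 8 + 6 / m * f x ^ 2) (stdGaussian (E n)) :=
      (integrable_const _).add hi₁
    calc ∫ x, shiftDensity h x * f x ∂(stdGaussian (E n))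
        ≤ ∫ x, (m / 8 + 6 / m * f x ^ 2 + m / 16 * (shiftDensity h x - 1) ^ 2)
            ∂(stdGaussian (E n)) := by
          refine integral_mono (hD.integrable_mul hfL) (hi₃.add hi₂) fun x => ?_
          dsimp only
          rw [← sub_nonneg]
          have e : m / 8 + 6 / m * f x ^ 2 + m / 16 * (shiftDensity h x - 1) ^ 2 -
              shiftDensity h x * f x = (m - 4 * f x) ^ 2 / (8 * m) +
                (8 * f x - m * (shiftDensity h x - 1)) ^ 2 / (16 * m) := by
            field_simp
            ring
          rw [e]
          positivity
      _ ≤ _ := by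
          rw [integral_add hi₃ hi₂, integral_add (integrable_const _) hi₁, integral_const_mul,
            integral_const_mul, integral_shiftDensity_sub_one_sq]
          simp only [integral_const, probReal_univ, one_smul]
          gcongr
          nlinarith
  have hlow : -(m / 8 + 2 / m * ε ^ 2) ≤ ∫ x, g x ∂(stdGaussian (E n)) := by
    have hi₁ := hgL.integrable_sq.const_mul (2 / m)
    have h₁ : ∫ x, -(m / 8 + 2 / m * g x ^ 2) ∂(stdGaussian (E n)) ≤
        ∫ x, g x ∂(stdGaussian (E n)) := by
      refine integral_mono ((integrable_const _).add hi₁).neg hgi fun x => ?_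
      dsimp only
      rw [neg_le_iff_add_nonneg]
      have e : g x + (m / 8 + 2 / m * g x ^ 2) = (m + 4 * g x) ^ 2 / (8 * m) := by
        field_simp
        ring
      rw [e]
      positivity
    rw [integral_neg, integral_add (integrable_const _) hi₁, integral_const_mul] at h₁
    simp only [integral_const, probReal_univ, one_smul] at h₁
    refine le_trans ?_ h₁
    gcongr
  have hfin : m * m ≤ m * (3 / 8 * m + 8 / m * ε ^ 2) := by
    gcongr
    have e : 8 / m * ε ^ 2 = 6 / m * ε ^ 2 + 2 / m * ε ^ 2 := by ring
    linarith
  rw [mul_add, ← mul_assoc, ← mul_assoc m (8 / m), mul_div_cancel₀ _ hm.ne'] at hfin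
  nlinarith

lemma min_le_mul_worstCaseRate (hK : IsCompact K) (hc : Convex ℝ K) (hσ : 0 < σ) : min σ (Metric.diam K) ≤ 8 * worstCaseRate K σ := by
  by_contra! hlt
  set ε := worstCaseRate K σ
  have hε : 0 ≤ ε := worstCaseRate_nonneg K σ
  obtain ⟨h₁, h₂⟩ := lt_min_iff.1 hlt
  have : Metric.diam K ≤ 4 * ε := by
    refine Metric.diam_le_of_forall_dist_le (by positivity) fun p hp q hq => ?_
    by_contra! hd
    rw [dist_eq_norm'] at hd
    have hpos : 0 < ‖q - p‖ := by linarith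
    -- The two-point bound needs a distance at most `σ`, so `q` is replaced by a point of the
    -- segment at distance `s` from `p`.
    obtain ⟨s, hs₁, hs₂⟩ := exists_between (lt_min hd (by linarith : 4 * ε < σ))
    have hsp : s / ‖q - p‖ ∈ Set.Icc (0 : ℝ) 1 := by
      refine ⟨by apply div_nonneg <;> linarith, (div_le_one hpos).2 (hs₂.le.trans (min_le_left _ _))⟩
    have hmem := hc.add_smul_sub_mem hp hq hsp
    have hnorm : ‖p + (s / ‖q - p‖) • (q - p) - p‖ = s := by
      rw [add_sub_cancel_left, norm_smul, Real.norm_of_nonneg hsp.1, div_mul_cancel₀ _ hpos.ne']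
    have := norm_sub_le_mul_worstCaseRate hK hc hσ hp hmem
      (hnorm.le.trans (hs₂.le.trans (min_le_right _ _)))
    rw [hnorm] at this
    exact absurd this hs₁.not_ge
  linarith

end Risk

/-! ### Local widths: variance and concavity in the radius. -/

section LocalWidth

variable {n : ℕ} {K : Set (E n)} {μ : E n} {r : ℝ}

lemma nonempty_closedBall_inter (hμ : μ ∈ K) (hr : 0 ≤ r) :
    (Metric.closedBall μ r ∩ K).Nonempty :=
  ⟨μ, Metric.mem_closedBall_self hr, hμ⟩

lemma gaussianWidth_mono {S T : Set (E n)} (hST : S ⊆ T) (hS : S.Nonempty)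
    (hT : T ⊆ Metric.closedBall μ r) : gaussianWidth S ≤ gaussianWidth T := by
  rw [gaussianWidth_eq_integral_suppFun hT (hS.mono hST),
    gaussianWidth_eq_integral_suppFun (hST.trans hT) hS]
  exact integral_mono (integrable_suppFun (hST.trans hT) hS)
    (integrable_suppFun hT (hS.mono hST)) fun x => suppFun_mono hST hS hT x

lemma localWidth_le_localWidth {ν : E n} {s : ℝ} (hν : ν ∈ K) (hs : 0 ≤ s)
    (h : dist ν μ + s ≤ r) : localWidth K ν s ≤ localWidth K μ r :=
  gaussianWidth_mono (Set.inter_subset_inter_left _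
    (Metric.closedBall_subset_closedBall' (by linarith)))
    (nonempty_closedBall_inter hν hs) Set.inter_subset_left

/-- The supremum `sup_{t ∈ B(μ, r) ∩ K} ⟨x, t - μ⟩`, whose mean is `localWidth K μ r`. -/
noncomputable def localSupp (K : Set (E n)) (μ : E n) (r : ℝ) (x : E n) : ℝ :=
  suppFun (Metric.closedBall μ r ∩ K) μ x

lemma inner_le_localSupp {t : E n} (ht : t ∈ K) (htr : ‖t - μ‖ ≤ r) (x : E n) :
    inner ℝ x (t - μ) ≤ localSupp K μ r x :=
  inner_le_suppFun Set.inter_subset_left x ⟨mem_closedBall_iff_norm.2 htr, ht⟩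

lemma localSupp_le (hμ : μ ∈ K) (hr : 0 ≤ r) {x : E n} {b : ℝ}
    (h : ∀ t ∈ K, ‖t - μ‖ ≤ r → inner ℝ x (t - μ) ≤ b) : localSupp K μ r x ≤ b :=
  suppFun_le (nonempty_closedBall_inter hμ hr) fun t ht =>
    h t ht.2 (mem_closedBall_iff_norm.1 ht.1)

lemma integrable_localSupp (hμ : μ ∈ K) (hr : 0 ≤ r) :
    Integrable (localSupp K μ r) (stdGaussian (E n)) :=
  integrable_suppFun Set.inter_subset_left (nonempty_closedBall_inter hμ hr)

lemma memLp_localSupp (hμ : μ ∈ K) (hr : 0 ≤ r) :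
    MemLp (localSupp K μ r) 2 (stdGaussian (E n)) :=
  memLp_suppFun Set.inter_subset_left (nonempty_closedBall_inter hμ hr)

lemma localWidth_eq_integral (hμ : μ ∈ K) (hr : 0 ≤ r) :
    localWidth K μ r = ∫ x, localSupp K μ r x ∂(stdGaussian (E n)) :=
  gaussianWidth_eq_integral_suppFun Set.inter_subset_left (nonempty_closedBall_inter hμ hr)

lemma integrable_localSupp_sub_sq (hμ : μ ∈ K) (hr : 0 ≤ r) :
    Integrable (fun x => (localSupp K μ r x - localWidth K μ r) ^ 2) (stdGaussian (E n)) :=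
  ((memLp_localSupp hμ hr).sub (memLp_const _)).integrable_sq

lemma integral_localSupp_sub_sq_le (hK : IsCompact K) (hc : Convex ℝ K) (hμ : μ ∈ K)
    (hr : 0 < r) :
    ∫ x, (localSupp K μ r x - localWidth K μ r) ^ 2 ∂(stdGaussian (E n)) ≤ 6 * r ^ 2 :=
  integral_sq_suppFun_sub_le hr (hK.inter_left Metric.isClosed_closedBall)
    ((convex_closedBall μ r).inter hc) (nonempty_closedBall_inter hμ hr.le) Set.inter_subset_left

/-- Already true pointwise in `x`: a convex combination of points of `K` at distances at most `r`
and `s` from `μ` lies in `K`, at distance at most `a r + b s`. -/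
lemma concaveOn_localWidth (hc : Convex ℝ K) (hμ : μ ∈ K) :
    ConcaveOn ℝ (Set.Ici 0) (localWidth K μ) := by
  refine concaveOn_iff_forall_pos.2 ⟨convex_Ici 0, fun r hr s hs a b ha hb hab => ?_⟩
  rw [Set.mem_Ici] at hr hs
  have h0 : 0 ≤ a * r + b * s := by positivity
  simp only [smul_eq_mul]
  rw [localWidth_eq_integral hμ hr, localWidth_eq_integral hμ hs, localWidth_eq_integral hμ h0,
    ← integral_const_mul, ← integral_const_mul,
    ← integral_add ((integrable_localSupp hμ hr).const_mul a)
      ((integrable_localSupp hμ hs).const_mul b)]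
  refine integral_mono (((integrable_localSupp hμ hr).const_mul a).add
      ((integrable_localSupp hμ hs).const_mul b)) (integrable_localSupp hμ h0) fun x => ?_
  dsimp only
  rw [← le_sub_iff_add_le, ← le_div_iff₀' ha]
  refine localSupp_le hμ hr fun t ht htr => ?_
  rw [le_div_iff₀' ha, le_sub_iff_add_le, ← le_sub_iff_add_le', ← le_div_iff₀' hb]
  refine localSupp_le hμ hs fun u hu hus => ?_
  rw [le_div_iff₀' hb, le_sub_iff_add_le']
  have e : a • t + b • u - μ = a • (t - μ) + b • (u - μ) := by
    have hμe : a • μ + b • μ = μ := by rw [← add_smul, hab, one_smul]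
    calc a • t + b • u - μ = a • t + b • u - (a • μ + b • μ) := by rw [hμe]
      _ = a • (t - μ) + b • (u - μ) := by module
  have hle := inner_le_localSupp (hc ht hu ha.le hb.le hab) (r := a * r + b * s) (μ := μ) (by
    rw [e]
    refine (norm_add_le _ _).trans ?_
    rw [norm_smul, norm_smul, Real.norm_of_nonneg ha.le, Real.norm_of_nonneg hb.le]
    gcongr) x
  rwa [e, inner_add_right, inner_smul_right, inner_smul_right] at hle

/-- Chord slopes of a concave function decrease from `[a, b]` to `[a, M]` to `[M, 2M]`. This carries
information from the packing scale to any larger scale. -/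
lemma localWidth_two_mul_sub_le (hc : Convex ℝ K) (hμ : μ ∈ K) {a b M : ℝ} (ha : 0 ≤ a)
    (hab : a < b) (hbM : b ≤ M) :
    localWidth K μ (2 * M) - localWidth K μ M ≤
      M * ((localWidth K μ b - localWidth K μ a) / (b - a)) := by
  have hw := concaveOn_localWidth hc hμ
  have hM : 0 < M := by linarith
  have h₁ := hw.slope_anti_adjacent (x := a) (y := M) (z := 2 * M) ha
    (by simpa using hM.le) (by linarith) (by linarith)
  have h₂ := hw.neg.secant_mono (a := a) (x := b) (y := M) ha (ha.trans hab.le) hM.le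
    hab.ne' (hab.trans_le hbM).ne' hbM
  simp only [Pi.neg_apply, neg_sub_neg] at h₂
  rw [← neg_sub (localWidth K μ b), ← neg_sub (localWidth K μ M), neg_div, neg_div,
    neg_le_neg_iff] at h₂
  have h₃ := h₁.trans h₂
  rw [show 2 * M - M = M by ring, div_le_iff₀ hM] at h₃
  linarith

end LocalWidth

/-! ### From growth of local widths to bounds on the risk. -/

section RiskBounds

variable {n : ℕ} {K : Set (E n)} {μ : E n} {σ : ℝ}

/-- If the least squares estimator is far from `μ`, the local supremum grows fast. -/
lemma mul_norm_le_of_lt_norm_lse_sub (hK : IsCompact K) (hc : Convex ℝ K) (hμ : μ ∈ K)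
    {M : ℝ} (hM : 0 < M) (x : E n) (hx : 2 * M < ‖lse K (μ + σ • x) - μ‖) (hσ : 0 < σ) :
    M * ‖lse K (μ + σ • x) - μ‖ ≤ σ * (localSupp K μ (2 * M) x - localSupp K μ M x) := by
  have hne : K.Nonempty := ⟨μ, hμ⟩
  have hpK := lse_mem hK hne (μ + σ • x)
  have hVI := fun {t : E n} (ht : t ∈ K) => lse_inner_le hK hc hne (μ + σ • x) ht
  set p := lse K (μ + σ • x)
  set t := ‖p - μ‖ with htdef
  have key : localSupp K μ M x ≤ localSupp K μ (2 * M) x - M * t / σ := by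
    refine localSupp_le hμ hM.le fun ν hν hνM => ?_
    -- Chosen so that the point of the segment from `ν` to `p` is at distance at most `(1 - l) M + l
    -- t = 2M` from `μ`.
    set l := M / (t - M) with hl
    have htM : 0 < t - M := by linarith
    have hl0 : 0 < l := by positivity
    have hl1 : l ≤ 1 := (div_le_one htM).2 (by linarith)
    have hlt : l * (t - M) = M := div_mul_cancel₀ _ htM.ne'
    have hmem := hc.add_smul_sub_mem hν hpK ⟨hl0.le, hl1⟩
    have e : ν + l • (p - ν) - μ = (1 - l) • (ν - μ) + l • (p - μ) := by module
    have e' : ν + l • (p - ν) - μ = (ν - μ) + l • (p - ν) := by module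
    have hnorm : ‖ν + l • (p - ν) - μ‖ ≤ 2 * M := by
      rw [e]
      refine (norm_add_le _ _).trans ?_
      rw [norm_smul, norm_smul, Real.norm_of_nonneg hl0.le,
        Real.norm_of_nonneg (sub_nonneg.2 hl1), ← htdef]
      have : (1 - l) * ‖ν - μ‖ ≤ (1 - l) * M :=
        mul_le_mul_of_nonneg_left hνM (sub_nonneg.2 hl1)
      linarith
    have h₁ := inner_le_localSupp hmem hnorm x
    rw [e', inner_add_right, inner_smul_right] at h₁
    have h₂ := hVI hν
    have e₂ : inner ℝ (μ + σ • x - p) (ν - p) =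
        -(σ * inner ℝ x (p - ν)) + t ^ 2 - inner ℝ (p - μ) (ν - μ) := by
      rw [htdef, ← real_inner_self_eq_norm_sq, ← real_inner_smul_left, ← inner_neg_right,
        add_sub_assoc]
      rw [show μ + (σ • x - p) = σ • x - (p - μ) by abel,
        show ν - p = (ν - μ) - (p - μ) by abel, show -(p - ν) = (ν - μ) - (p - μ) by abel]
      simp only [inner_sub_left, inner_sub_right]
      ring
    have h₃ : inner ℝ (p - μ) (ν - μ) ≤ t * M :=
      (real_inner_le_norm _ _).trans (by rw [← htdef]; gcongr)
    have h₄ : t * (t - M) ≤ σ * inner ℝ x (p - ν) := by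
      rw [e₂] at h₂
      linarith
    have h₅ : M * t ≤ σ * (l * inner ℝ x (p - ν)) := by
      have := mul_le_mul_of_nonneg_left h₄ hl0.le
      have e₃ : l * (t * (t - M)) = M * t := by rw [mul_comm t, ← mul_assoc, hlt]
      linarith
    have h₆ : M * t / σ ≤ l * inner ℝ x (p - ν) := (div_le_iff₀' hσ).2 h₅
    linarith
  have h := mul_le_mul_of_nonneg_left key hσ.le
  have e : σ * (localSupp K μ (2 * M) x - M * t / σ) = σ * localSupp K μ (2 * M) x - M * t := by
    field_simp
  rw [e] at h
  linarith

/-- If the least squares estimator is close to `μ`, the local supremum grows slowly. -/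
lemma localSupp_sub_le_of_norm_lse_sub_le (hK : IsCompact K) (hc : Convex ℝ K) (hμ : μ ∈ K)
    {s R : ℝ} (hsR : s < R) (x : E n) (hx : ‖lse K (μ + σ • x) - μ‖ ≤ s) (hσ : 0 < σ) :
    σ * (localSupp K μ R x - localSupp K μ s x) ≤ ‖lse K (μ + σ • x) - μ‖ * (R - s) := by
  have hne : K.Nonempty := ⟨μ, hμ⟩
  have hpK := lse_mem hK hne (μ + σ • x)
  have hVI := fun {t : E n} (ht : t ∈ K) => lse_inner_le hK hc hne (μ + σ • x) ht
  set p := lse K (μ + σ • x)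
  set t := ‖p - μ‖ with htdef
  have ht0 : 0 ≤ t := norm_nonneg _
  have key : localSupp K μ R x ≤ localSupp K μ s x + t * (R - s) / σ := by
    refine localSupp_le hμ (by linarith) fun ν hν hνR => ?_
    have hRt : 0 < R - t := by linarith
    -- Chosen so that `(1 - l) t + l R = s`: moving `ν` towards `p` brings it into the ball of
    -- radius `s`.
    set l := (s - t) / (R - t) with hl
    have hl0 : 0 ≤ l := div_nonneg (by linarith) hRt.le
    have hl1 : l ≤ 1 := (div_le_one hRt).2 (by linarith)
    have hlt : l * (R - t) = s - t := div_mul_cancel₀ _ hRt.ne'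
    have hmem := hc.add_smul_sub_mem hpK hν ⟨hl0, hl1⟩
    have e : p + l • (ν - p) - μ = (1 - l) • (p - μ) + l • (ν - μ) := by module
    have e' : p + l • (ν - p) - μ = (ν - μ) - (1 - l) • (ν - p) := by module
    have hnorm : ‖p + l • (ν - p) - μ‖ ≤ s := by
      rw [e]
      refine (norm_add_le _ _).trans ?_
      rw [norm_smul, norm_smul, Real.norm_of_nonneg hl0,
        Real.norm_of_nonneg (sub_nonneg.2 hl1), ← htdef]
      have : l * ‖ν - μ‖ ≤ l * R := mul_le_mul_of_nonneg_left hνR hl0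
      linarith
    have h₁ := inner_le_localSupp hmem hnorm x
    rw [e', inner_sub_right, inner_smul_right] at h₁
    have h₂ := hVI hν
    have e₂ : inner ℝ (μ + σ • x - p) (ν - p) =
        σ * inner ℝ x (ν - p) + t ^ 2 - inner ℝ (p - μ) (ν - μ) := by
      rw [htdef, ← real_inner_self_eq_norm_sq, ← real_inner_smul_left, add_sub_assoc,
        show μ + (σ • x - p) = σ • x - (p - μ) by abel,
        show ν - p = (ν - μ) - (p - μ) by abel]
      simp only [inner_sub_left, inner_sub_right]
      ring
    have h₃ : inner ℝ (p - μ) (ν - μ) ≤ t * R :=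
      (real_inner_le_norm _ _).trans (by rw [← htdef]; gcongr)
    have h₄ : σ * inner ℝ x (ν - p) ≤ t * (R - t) := by
      rw [e₂] at h₂
      linarith
    have h₅ : σ * ((1 - l) * inner ℝ x (ν - p)) ≤ t * (R - s) := by
      have := mul_le_mul_of_nonneg_left h₄ (sub_nonneg.2 hl1)
      have e₃ : (1 - l) * (t * (R - t)) = t * (R - s) := by
        linear_combination (-t) * hlt
      linarith
    have h₆ : (1 - l) * inner ℝ x (ν - p) ≤ t * (R - s) / σ := (le_div_iff₀' hσ).2 h₅
    linarith
  have h := mul_le_mul_of_nonneg_left key hσ.le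
  have e : σ * (localSupp K μ s x + t * (R - s) / σ) =
      σ * localSupp K μ s x + t * (R - s) := by
    field_simp
  rw [e] at h
  linarith

/-- An error `t > 2M` satisfies `M t ≤ σ (F_{2M} - F_M)`, whose mean is at most `M²`; the rest is
fluctuation. Variances `6M²` and `24M²` contribute `90 σ² ≤ 90 M²`. -/
lemma lseRisk_le_of_localWidth_sub_le (hK : IsCompact K) (hc : Convex ℝ K) (hμ : μ ∈ K)
    (hσ : 0 < σ) {M : ℝ} (hσM : σ ≤ M)
    (hw : σ * (localWidth K μ (2 * M) - localWidth K μ M) ≤ M ^ 2) :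
    lseRisk K σ μ ≤ (10 * M) ^ 2 := by
  have hM : 0 < M := hσ.trans_le hσM
  have hM2 : 0 < 2 * M := by positivity
  have hmono : localWidth K μ M ≤ localWidth K μ (2 * M) :=
    localWidth_le_localWidth hμ hM.le (by rw [dist_self]; linarith)
  have hi₁ := integrable_localSupp_sub_sq hμ hM.le
  have hi₂ := integrable_localSupp_sub_sq hμ hM2.le
  have hv₁ := integral_localSupp_sub_sq_le hK hc hμ hM
  have hv₂ := integral_localSupp_sub_sq_le hK hc hμ hM2
  set w₁ := localWidth K μ M
  set w₂ := localWidth K μ (2 * M)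
  have hww : (σ * (w₂ - w₁)) ^ 2 ≤ (M ^ 2) ^ 2 :=
    pow_le_pow_left₀ (mul_nonneg hσ.le (sub_nonneg.2 hmono)) hw 2
  have hpt (x : E n) : ‖lse K (μ + σ • x) - μ‖ ^ 2 ≤
      7 * M ^ 2 + 3 * σ ^ 2 / M ^ 2 *
        ((localSupp K μ M x - w₁) ^ 2 + (localSupp K μ (2 * M) x - w₂) ^ 2) := by
    have hnn : 0 ≤ 3 * σ ^ 2 / M ^ 2 *
        ((localSupp K μ M x - w₁) ^ 2 + (localSupp K μ (2 * M) x - w₂) ^ 2) := by positivity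
    rcases le_or_gt ‖lse K (μ + σ • x) - μ‖ (2 * M) with hle | hgt
    · have : ‖lse K (μ + σ • x) - μ‖ ^ 2 ≤ (2 * M) ^ 2 := by gcongr
      nlinarith
    · have h := mul_norm_le_of_lt_norm_lse_sub hK hc hμ hM x hgt hσ
      set t := ‖lse K (μ + σ • x) - μ‖
      have ht : 0 ≤ t := norm_nonneg _
      have h₂ : (M * t) ^ 2 ≤ (σ * (localSupp K μ (2 * M) x - localSupp K μ M x)) ^ 2 :=
        pow_le_pow_left₀ (by positivity) h 2
      set u := localSupp K μ M x - w₁ with hu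
      set v := localSupp K μ (2 * M) x - w₂ with hv
      have e : localSupp K μ (2 * M) x - localSupp K μ M x = (w₂ - w₁) + v - u := by
        rw [hu, hv]; ring
      rw [e] at h₂
      have h₃ : ((w₂ - w₁) + v - u) ^ 2 ≤ 3 * ((w₂ - w₁) ^ 2 + (u ^ 2 + v ^ 2)) := by
        nlinarith [sq_nonneg ((w₂ - w₁) - v), sq_nonneg ((w₂ - w₁) + u), sq_nonneg (v + u)]
      have h₄ : (M * t) ^ 2 ≤ 3 * (M ^ 2) ^ 2 + 3 * σ ^ 2 * (u ^ 2 + v ^ 2) := by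
        have := mul_le_mul_of_nonneg_left h₃ (sq_nonneg σ)
        nlinarith
      have h₅ : t ^ 2 ≤ 3 * M ^ 2 + 3 * σ ^ 2 / M ^ 2 * (u ^ 2 + v ^ 2) := by
        have hM' : 0 < M ^ 2 := by positivity
        refine le_of_mul_le_mul_left ?_ hM'
        calc M ^ 2 * t ^ 2 = (M * t) ^ 2 := by ring
          _ ≤ _ := h₄
          _ = _ := by field_simp
      have : 0 ≤ M ^ 2 := sq_nonneg M
      linarith
  have hi₃ : Integrable (fun x => 3 * σ ^ 2 / M ^ 2 *
      ((localSupp K μ M x - w₁) ^ 2 + (localSupp K μ (2 * M) x - w₂) ^ 2)) (stdGaussian (E n)) :=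
    (hi₁.add hi₂).const_mul _
  calc lseRisk K σ μ
      ≤ ∫ x, (7 * M ^ 2 + 3 * σ ^ 2 / M ^ 2 *
          ((localSupp K μ M x - w₁) ^ 2 + (localSupp K μ (2 * M) x - w₂) ^ 2))
          ∂(stdGaussian (E n)) :=
        integral_mono_of_nonneg (.of_forall fun _ => sq_nonneg _)
          ((integrable_const _).add hi₃) (.of_forall hpt)
    _ ≤ 7 * M ^ 2 + 3 * σ ^ 2 / M ^ 2 * (6 * M ^ 2 + 6 * (2 * M) ^ 2) := by
        rw [integral_add (integrable_const _) hi₃, integral_const_mul (3 * σ ^ 2 / M ^ 2),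
          integral_add hi₁ hi₂]
        simp only [integral_const, probReal_univ, one_smul]
        gcongr
    _ = 7 * M ^ 2 + 90 * σ ^ 2 := by
        field_simp
        ring
    _ ≤ (10 * M) ^ 2 := by
        have : σ ^ 2 ≤ M ^ 2 := by gcongr
        nlinarith

/-- An error below `s` keeps `σ (F_R - F_s)` under `s (R - s)`, whereas its mean is at least `(R +
s)(R - s) / 2`. The deficit `(R - s)² / 2 ≥ s (R - s) / 2` must come from fluctuations, which
Chebyshev-style weighting charges to `σ²`. -/
lemma sq_le_lseRisk_add (hK : IsCompact K) (hc : Convex ℝ K) (hμ : μ ∈ K)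
    (hσ : 0 < σ) {s R : ℝ} (hs : 0 < s) (hsR : 2 * s ≤ R)
    (hw : (R ^ 2 - s ^ 2) / 2 ≤ σ * (localWidth K μ R - localWidth K μ s)) :
    s ^ 2 ≤ lseRisk K σ μ + 240 * σ ^ 2 := by
  have hR : 0 < R := by linarith
  have hRs : 0 < R - s := by linarith
  have hi₁ := integrable_localSupp_sub_sq hμ hs.le
  have hi₂ := integrable_localSupp_sub_sq hμ hR.le
  have hv₁ := integral_localSupp_sub_sq_le hK hc hμ hs
  have hv₂ := integral_localSupp_sub_sq_le hK hc hμ hR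
  set w₁ := localWidth K μ s
  set w₂ := localWidth K μ R
  have hpt (x : E n) : s ^ 2 ≤ ‖lse K (μ + σ • x) - μ‖ ^ 2 + 8 * σ ^ 2 / (R - s) ^ 2 *
        ((localSupp K μ s x - w₁) ^ 2 + (localSupp K μ R x - w₂) ^ 2) := by
    have hnn : 0 ≤ 8 * σ ^ 2 / (R - s) ^ 2 *
        ((localSupp K μ s x - w₁) ^ 2 + (localSupp K μ R x - w₂) ^ 2) := by positivity
    rcases le_or_gt s ‖lse K (μ + σ • x) - μ‖ with hle | hgt
    · have : s ^ 2 ≤ ‖lse K (μ + σ • x) - μ‖ ^ 2 := by gcongr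
      linarith
    · have h := localSupp_sub_le_of_norm_lse_sub_le hK hc hμ (by linarith) x hgt.le hσ (R := R)
      set t := ‖lse K (μ + σ • x) - μ‖
      set u := localSupp K μ s x - w₁ with hu
      set v := localSupp K μ R x - w₂ with hv
      have e : localSupp K μ R x - localSupp K μ s x = (w₂ - w₁) + v - u := by
        rw [hu, hv]; ring
      rw [e] at h
      have h₁ : t * (R - s) ≤ s * (R - s) := by gcongr
      have h₂ : s * (R - s) ≤ 2 * (σ * (u - v)) := by nlinarith
      have h₃ : (s * (R - s)) ^ 2 ≤ (2 * (σ * (u - v))) ^ 2 :=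
        pow_le_pow_left₀ (by positivity) h₂ 2
      have h₄ : (s * (R - s)) ^ 2 ≤ 8 * σ ^ 2 * (u ^ 2 + v ^ 2) := by
        have : (u - v) ^ 2 ≤ 2 * (u ^ 2 + v ^ 2) := by nlinarith [sq_nonneg (u + v)]
        have := mul_le_mul_of_nonneg_left this (sq_nonneg σ)
        nlinarith
      have h₅ : s ^ 2 ≤ 8 * σ ^ 2 / (R - s) ^ 2 * (u ^ 2 + v ^ 2) := by
        rw [div_mul_eq_mul_div, le_div_iff₀ (by positivity)]
        linarith [mul_pow s (R - s) 2]
      have : 0 ≤ t ^ 2 := sq_nonneg t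
      linarith
  have hi₃ : Integrable (fun x => 8 * σ ^ 2 / (R - s) ^ 2 *
      ((localSupp K μ s x - w₁) ^ 2 + (localSupp K μ R x - w₂) ^ 2)) (stdGaussian (E n)) :=
    (hi₁.add hi₂).const_mul _
  have hne : K.Nonempty := ⟨μ, hμ⟩
  have hi₄ := integrable_norm_lse_sub_sq hK hc hne σ hμ
  calc s ^ 2 = ∫ _, s ^ 2 ∂(stdGaussian (E n)) := by simp
    _ ≤ ∫ x, (‖lse K (μ + σ • x) - μ‖ ^ 2 + 8 * σ ^ 2 / (R - s) ^ 2 *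
          ((localSupp K μ s x - w₁) ^ 2 + (localSupp K μ R x - w₂) ^ 2))
          ∂(stdGaussian (E n)) :=
        integral_mono (integrable_const _) (hi₄.add hi₃) hpt
    _ ≤ lseRisk K σ μ + 8 * σ ^ 2 / (R - s) ^ 2 * (6 * s ^ 2 + 6 * R ^ 2) := by
        rw [integral_add hi₄ hi₃, integral_const_mul, integral_add hi₁ hi₂]
        unfold lseRisk
        gcongr
    _ ≤ lseRisk K σ μ + 240 * σ ^ 2 := by
        refine add_le_add_right ?_ _
        rw [div_mul_eq_mul_div, div_le_iff₀ (by positivity)]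
        have : 6 * s ^ 2 + 6 * R ^ 2 ≤ 30 * (R - s) ^ 2 := by nlinarith
        nlinarith [mul_le_mul_of_nonneg_left this (sq_nonneg σ)]

end RiskBounds

/-! ### Executions of the breadth-first search. -/

section Algorithm

variable {n : ℕ} {K : Set (E n)} {σ c : ℝ}

/-- A point farther than `δ` from all of `P` could be added to it, against maximal cardinality: a
largest packing is a covering. -/
lemma IsMaxPacking.exists_dist_le {δ : ℝ} {T : Set (E n)} {P : List (E n)}
    (h : IsMaxPacking δ T P) (hδ : 0 ≤ δ) {x : E n} (hx : x ∈ T) : ∃ p ∈ P, dist x p ≤ δ := by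
  classical
  by_contra! hfar
  have hxP : x ∉ {p | p ∈ P} := fun hmem => by simpa using (hfar x hmem).trans_le' hδ
  have hsep : Metric.IsSeparated (δ.toNNReal : ENNReal) (insert x {p | p ∈ P}) := by
    refine (Metric.isSeparated_insert_of_notMem hxP).2 ⟨h.separated, fun y hy => ?_⟩
    rw [edist_dist]
    exact (ENNReal.ofReal_lt_ofReal_iff (hδ.trans_lt (hfar y hy))).2 (hfar y hy)
  have hle : (insert x {p | p ∈ P}).encard ≤ Metric.packingNumber δ.toNNReal T :=
    hsep.encard_le_packingNumber (Set.insert_subset hx h.subset)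
  have hcard : ({p | p ∈ P} : Set (E n)).encard = P.length := by
    rw [← List.toFinset_card_of_nodup h.nodup, ← Set.encard_coe_eq_coe_finsetCard]
    congr 1
    ext
    simp
  rw [Set.encard_insert_of_notMem hxP, hcard, ← h.card_eq] at hle
  have : (P.length + 1 : ℕ) ≤ P.length := by exact_mod_cast hle
  omega

/-- The nodes of a queue are points of `K`, and their levels decrease by at most one in total. -/
def IsGoodQueue (K : Set (E n)) (Q : List (E n × ℕ)) : Prop :=
  (∀ a ∈ Q, a.1 ∈ K) ∧ Q.Pairwise fun a b => b.2 ≤ a.2 ∧ a.2 ≤ b.2 + 1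

/-- The invariant of the executions of the algorithm. -/
def IsGoodConfig (K : Set (E n)) (σ c : ℝ) : Config n → Prop
  | .searching Q => IsGoodQueue K Q
  | .returned k _ => ∃ ν ∈ K, ∃ P γ, IsChildrenDistance K σ c ν k P γ ∧ 0 < γ

/-- The removed node has the least level `k`, so all others have level `k` or `k + 1`, and children
of level `k + 1` may be put in front. -/
lemma IsGoodQueue.expand {Q : List (E n × ℕ)} {ν : E n} {k : ℕ} {P : List (E n)}
    (h : IsGoodQueue K (Q ++ [(ν, k)])) (hP : ∀ p ∈ P, p ∈ K) :
    IsGoodQueue K (P.reverse.map (fun p => (p, k + 1)) ++ Q) := by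
  obtain ⟨hK, hQ⟩ := h
  rw [List.pairwise_append] at hQ
  obtain ⟨hQ, -, hlast⟩ := hQ
  refine ⟨fun a ha => ?_, List.pairwise_append.2 ⟨?_, hQ, ?_⟩⟩
  · rcases List.mem_append.1 ha with ha | ha
    · obtain ⟨p, hp, rfl⟩ := List.mem_map.1 ha
      exact hP p (List.mem_reverse.1 hp)
    · exact hK a (List.mem_append_left _ ha)
  · refine List.pairwise_map.2 (List.pairwise_of_forall fun _ _ => ?_)
    simp
  · intro a ha b hb
    obtain ⟨p, -, rfl⟩ := List.mem_map.1 ha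
    have := hlast b hb (ν, k) (by simp)
    simp only at this ⊢
    omega

lemma IsChildrenDistance.mem {ν : E n} {k : ℕ} {P : List (E n)} {γ : ℝ}
    (h : IsChildrenDistance K σ c ν k P γ) : ∀ p ∈ P, p ∈ K :=
  fun p hp => (h.1.subset p hp).2

lemma Step.isGoodConfig {C C' : Config n} (h : Step K σ c C C') (hC : IsGoodConfig K σ c C) :
    IsGoodConfig K σ c C' := by
  cases h with
  | halt Q ν k P γ h hγ => exact ⟨ν, hC.1 (ν, k) (by simp), P, γ, h, hγ⟩
  | expand Q ν k P γ h hγ => exact IsGoodQueue.expand hC h.mem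
  | idle_returned k β => exact hC
  | idle_empty => exact hC

lemma IsExecution.isGoodConfig {s : ℕ → Config n} (h : IsExecution K σ c s) (t : ℕ) :
    IsGoodConfig K σ c (s t) := by
  induction t with
  | zero =>
    obtain ⟨ν, hν, h0⟩ := h.start
    rw [h0]
    exact ⟨by simpa using hν, List.pairwise_singleton _ _⟩
  | succ t ih => exact (h.step t).isGoodConfig ih

lemma Step.of_searching {Q : List (E n × ℕ)} {ν : E n} {k : ℕ} {C : Config n}
    (h : Step K σ c (.searching (Q ++ [(ν, k)])) C) :
    C = .returned k (scale K c k) ∨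
      ∃ P γ, IsChildrenDistance K σ c ν k P γ ∧ γ ≤ 0 ∧
        C = .searching (P.reverse.map (fun p => (p, k + 1)) ++ Q) := by
  generalize hC : Config.searching (Q ++ [(ν, k)]) = C₀ at h
  cases h with
  | halt Q' ν' k' P γ h hγ =>
    obtain ⟨-, he⟩ := List.append_inj' (Config.searching.inj hC) rfl
    obtain ⟨rfl, rfl⟩ : ν = ν' ∧ k = k' := by simpa using he
    exact .inl rfl
  | expand Q' ν' k' P γ h hγ =>
    obtain ⟨rfl, he⟩ := List.append_inj' (Config.searching.inj hC) rfl
    obtain ⟨rfl, rfl⟩ : ν = ν' ∧ k = k' := by simpa using he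
    exact .inr ⟨P, γ, h, hγ, rfl⟩
  | idle_returned k β => exact absurd hC (by simp)
  | idle_empty => exact absurd hC (by simp)

/-- In a search that does not stop early, every queued node is eventually expanded. -/
lemma IsExecution.exists_expand {s : ℕ → Config n} (h : IsExecution K σ c s) {k : ℕ}
    (hk : ¬ TerminatesWithin s k) {ν : E n} {j : ℕ} (hj : j ≤ k) (R : List (E n × ℕ)) :
    ∀ (t : ℕ) (Q : List (E n × ℕ)), s t = .searching (Q ++ (ν, j) :: R) →
      ∃ P γ t' Q', IsChildrenDistance K σ c ν j P γ ∧ γ ≤ 0 ∧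
        s t' = .searching (P.reverse.map (fun p => (p, j + 1)) ++ Q') := by
  -- The end of the list is served first, so `R` holds the nodes still ahead of `(ν, j)`.
  induction R using List.reverseRecOn with
  | nil =>
    intro t Q ht
    have hs := h.step t
    rw [ht] at hs
    rcases hs.of_searching with hr | ⟨P, γ, hP, hγ, he⟩
    · exact absurd ⟨j, hj, t + 1, _, hr⟩ hk
    · exact ⟨P, γ, t + 1, Q, hP, hγ, he⟩
  | append_singleton R a ih =>
    obtain ⟨ν', j'⟩ := a
    intro t Q ht
    have hgood := h.isGoodConfig t
    have hs := h.step t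
    have e : Q ++ (ν, j) :: (R ++ [(ν', j')]) = (Q ++ (ν, j) :: R) ++ [(ν', j')] := by simp
    rw [ht, e] at hgood hs
    -- Levels do not increase towards the served end, so a stop at this node would also be a stop
    -- within `k` iterations.
    have hj' : j' ≤ j :=
      ((List.pairwise_append.1 hgood.2).2.2 (ν, j) (by simp) (ν', j') (by simp)).1
    rcases hs.of_searching with hr | ⟨P, γ, hP, hγ, he⟩
    · exact absurd ⟨j', hj'.trans hj, t + 1, _, hr⟩ hk
    · exact ih (t + 1) _ (he.trans (by rw [List.append_assoc]))

lemma scale_nonneg (K : Set (E n)) (hc : 0 ≤ c) (k : ℕ) : 0 ≤ scale K c k :=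
  div_nonneg Metric.diam_nonneg (by positivity)

lemma scale_succ {k : ℕ} (hk : 1 ≤ k) : scale K c k = 2 * scale K c (k + 1) := by
  obtain ⟨k, rfl⟩ : ∃ m, k = m + 1 := ⟨k - 1, by omega⟩
  simp only [scale, Nat.add_sub_cancel, pow_succ]
  rw [mul_right_comm, ← div_div _ _ (2 : ℝ), mul_div_cancel₀ _ two_ne_zero]

/-- Descend the tree towards `μ`. The root ball has radius `diam K` and contains `K`. Below, a
packing point lies within `δ_j = 2 δ_{j+1}` of `μ`, so radius `(c - 2) δ_{j+1}` around `μ` fits in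
radius `c δ_{j+1}` around it. -/
lemma exists_expanded_node (hK : IsCompact K) (hc : 4 < c) {s : ℕ → Config n}
    (h : IsExecution K σ c s) {k : ℕ} (hk : ¬ TerminatesWithin s k) {μ : E n} (hμ : μ ∈ K)
    {j : ℕ} (hj : 1 ≤ j) (hjk : j ≤ k) :
    ∃ ν ∈ K, (∀ x ∈ K, dist x μ ≤ scale K c j * (c - 2) → dist x ν ≤ scale K c j * c) ∧
      ∃ P γ t Q, IsChildrenDistance K σ c ν j P γ ∧ γ ≤ 0 ∧
        s t = .searching (P.reverse.map (fun p => (p, j + 1)) ++ Q) := by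
  induction j, hj using Nat.le_induction with
  | base =>
    obtain ⟨ν, hν, h0⟩ := h.start
    refine ⟨ν, hν, fun x hx _ => ?_, h.exists_expand hk hjk [] 0 [] h0⟩
    have e : scale K c 1 * c = Metric.diam K := by
      have : c ≠ 0 := by linarith
      simp [scale, this]
    rw [e]
    exact Metric.dist_le_diam_of_mem hK.isBounded hx hν
  | succ j hj ih =>
    obtain ⟨ν, hν, hball, P, γ, t, Q, hP, hγ, ht⟩ := ih (by omega)
    have hδ := scale_nonneg K (by linarith : 0 ≤ c) j
    have hμT : μ ∈ Metric.closedBall ν (scale K c j * c) ∩ K :=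
      ⟨hball μ hμ (by rw [dist_self]; exact mul_nonneg hδ (by linarith)), hμ⟩
    obtain ⟨p, hp, hpd⟩ := hP.1.exists_dist_le hδ hμT
    refine ⟨p, hP.mem p hp, fun x _ hx => ?_, ?_⟩
    · have := dist_triangle x μ p
      rw [scale_succ hj] at hpd
      linarith
    · obtain ⟨A, B, hAB⟩ := List.append_of_mem
        (List.mem_map_of_mem (f := fun p => (p, j + 1)) (List.mem_reverse.2 hp))
      refine h.exists_expand hk hjk (B ++ Q) t A ?_
      rw [ht, hAB]
      simp

/-- If the search passes level `k`, the local widths grow slowly at scale `scale K c k`. -/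
lemma localWidth_sub_le_of_not_terminatesWithin (hK : IsCompact K) (hc : 4 < c)
    {s : ℕ → Config n} (h : IsExecution K σ c s) {k : ℕ} (hk1 : 1 ≤ k)
    (hk : ¬ TerminatesWithin s k) {μ : E n} (hμ : μ ∈ K) :
    localWidth K μ (scale K c k * (c - 2)) - localWidth K μ (2 * scale K c k) ≤
      (4 - 1 / c ^ 2) * (scale K c k * c) ^ 2 / (2 * σ) := by
  obtain ⟨ν, hν, hball, P, γ, -, -, hP, hγ, -⟩ := exists_expanded_node hK hc h hk hμ hk1 le_rfl
  have hδ := scale_nonneg K (by linarith : 0 ≤ c) k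
  have hδ2 : 0 ≤ scale K c k * (c - 2) := mul_nonneg hδ (by linarith)
  have hμT : μ ∈ Metric.closedBall ν (scale K c k * c) ∩ K :=
    ⟨hball μ hμ (by rwa [dist_self]), hμ⟩
  obtain ⟨q, hq, hqd⟩ := hP.1.exists_dist_le hδ hμT
  obtain ⟨p, -, hmin, rfl⟩ := hP.2
  -- The minimum over the packing is at most the value at the point `q` near `μ`, and `B(q, δ) ⊆
  -- B(μ, 2δ)`.
  have h₁ : localWidth K q (scale K c k) ≤ localWidth K μ (2 * scale K c k) :=
    localWidth_le_localWidth (hP.mem q hq) hδ (by rw [dist_comm]; linarith)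
  have h₂ : localWidth K μ (scale K c k * (c - 2)) ≤ localWidth K ν (scale K c k * c) :=
    gaussianWidth_mono (fun x hx => ⟨hball x hx.2 hx.1, hx.2⟩)
      (nonempty_closedBall_inter hμ hδ2) Set.inter_subset_left
  have := hmin q hq
  linarith

/-- If the search stops at level `k`, some local width grows fast from scale `scale K c k`. -/
lemma exists_localWidth_sub_gt_of_terminatesAfter (hc : 4 < c) (hσ : 0 < σ) {s : ℕ → Config n}
    (h : IsExecution K σ c s) {k : ℕ} (hk : TerminatesAfter s k) :
    ∃ μ ∈ K, ((2 * c * scale K c k) ^ 2 - scale K c k ^ 2) / 2 <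
      σ * (localWidth K μ (2 * c * scale K c k) - localWidth K μ (scale K c k)) := by
  obtain ⟨t, β, ht⟩ := hk
  have hgood := h.isGoodConfig t
  rw [ht] at hgood
  obtain ⟨ν, hν, P, γ, hP, hγ⟩ := hgood
  obtain ⟨p, hp, -, rfl⟩ := hP.2
  have hδ := scale_nonneg K (by linarith : 0 ≤ c) k
  refine ⟨p, hP.mem p hp, ?_⟩
  have hpν := (hP.1.subset p hp).1
  rw [Metric.mem_closedBall'] at hpν
  have h₁ : localWidth K ν (scale K c k * c) ≤ localWidth K p (2 * c * scale K c k) :=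
    localWidth_le_localWidth hν (mul_nonneg hδ (by linarith)) (by linarith)
  have h₂ : (4 - 1 / c ^ 2) * (scale K c k * c) ^ 2 / (2 * σ) <
      localWidth K p (2 * c * scale K c k) - localWidth K p (scale K c k) := by linarith
  rw [div_lt_iff₀ (by positivity)] at h₂
  -- This identity is the reason for the value of `C`.
  have e : (4 - 1 / c ^ 2) * (scale K c k * c) ^ 2 =
      (2 * c * scale K c k) ^ 2 - scale K c k ^ 2 := by
    have : c ≠ 0 := by linarith
    field_simp
    ring
  rw [e] at h₂
  linarith

end Algorithm

/-! ### Assembling the bounds. -/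

section Main

variable {n : ℕ} {K : Set (E n)} {σ c : ℝ}

lemma scale_le_mul_worstCaseRate (hK : IsCompact K) (hcv : Convex ℝ K) (hσ : 0 < σ) (hc : 4 < c)
    {s : ℕ → Config n} (h : IsExecution K σ c s) {k : ℕ} (hk : TerminatesAfter s k) :
    scale K c k ≤ 124 * worstCaseRate K σ := by
  obtain ⟨μ, hμ, hw⟩ := exists_localWidth_sub_gt_of_terminatesAfter hc hσ h hk
  have hne : K.Nonempty := ⟨μ, hμ⟩
  have hε := worstCaseRate_nonneg K σ
  rcases eq_or_lt_of_le (scale_nonneg K (by linarith : 0 ≤ c) k) with h0 | hδ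
  · rw [← h0]; positivity
  have hδd : scale K c k ≤ Metric.diam K := by
    refine div_le_self Metric.diam_nonneg ?_
    have : (1 : ℝ) ≤ 2 ^ (k - 1) := one_le_pow₀ one_le_two
    nlinarith
  have hmin := min_le_mul_worstCaseRate hK hcv hσ
  rcases le_total σ (Metric.diam K) with hle | hle
  · rw [min_eq_left hle] at hmin
    have h₁ := sq_le_lseRisk_add hK hcv hμ hσ hδ
      (by nlinarith : 2 * scale K c k ≤ 2 * c * scale K c k) hw.le
    have h₂ := lseRisk_le_worstCaseRate_sq hK hne σ hμ
    have h₃ : σ ^ 2 ≤ (8 * worstCaseRate K σ) ^ 2 := by gcongr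
    -- `1 + 240 · 64 = 15361 ≤ 124²`.
    exact le_of_sq_le_sq (by nlinarith) (by positivity)
  · rw [min_eq_right hle] at hmin
    linarith

/-- `M ≥ σ` controls the fluctuations and `M ≥ c' d / 2^k` the growth of the width. Both upper
bounds of the theorem follow, with `M = σ` and `M = c' d / 2^k`. -/
lemma worstCaseRate_le_mul_max (hK : IsCompact K) (hcv : Convex ℝ K) (hne : K.Nonempty)
    (hσ : 0 < σ) (hc : 4 < c) {s : ℕ → Config n} (h : IsExecution K σ c s) {k : ℕ}
    (hk1 : 1 ≤ k) (hk : ¬ TerminatesWithin s k) {M : ℝ} (hσM : σ ≤ M)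
    (hM : cPrime c * (Metric.diam K / 2 ^ k) ≤ M) : worstCaseRate K σ ≤ 10 * M := by
  have hM0 : 0 < M := hσ.trans_le hσM
  rcases eq_or_lt_of_le (scale_nonneg K (by linarith : 0 ≤ c) k) with h0 | hδ
  · have hd : Metric.diam K = 0 := by
      have : (2 : ℝ) ^ (k - 1) * c ≠ 0 := by positivity
      simpa [scale, this] using h0.symm
    have := worstCaseRate_le_diam hK hne σ
    linarith
  set δ := scale K c k with hδdef
  have hc4 : 0 < c - 4 := by linarith
  have hc0 : 0 < c := by linarith
  have hdiam : Metric.diam K / 2 ^ k = δ * c / 2 := by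
    obtain ⟨m, rfl⟩ : ∃ m, k = m + 1 := ⟨k - 1, by omega⟩
    simp only [hδdef, scale, Nat.add_sub_cancel, pow_succ]
    field_simp
  have hC : 3 ≤ 4 - 1 / c ^ 2 := by
    have : 1 / c ^ 2 ≤ 1 := by
      rw [div_le_one (by positivity)]
      nlinarith
    linarith
  have hL : cPrime c * (Metric.diam K / 2 ^ k) = (c - 2) * (4 - 1 / c ^ 2) * c * δ / (c - 4) := by
    rw [hdiam, cPrime]
    field_simp
    ring
  rw [hL] at hM
  have hbM : δ * (c - 2) ≤ M := by
    refine le_trans ?_ hM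
    rw [le_div_iff₀ hc4]
    have : c - 4 ≤ (4 - 1 / c ^ 2) * c := by nlinarith
    have := mul_le_mul_of_nonneg_left this (mul_nonneg hδ.le (by linarith : 0 ≤ c - 2))
    linarith
  refine worstCaseRate_le hne (by positivity) fun μ hμ => ?_
  refine lseRisk_le_of_localWidth_sub_le hK hcv hμ hσ hσM ?_
  have hw := localWidth_sub_le_of_not_terminatesWithin hK hc h hk1 hk hμ
  have hslope := localWidth_two_mul_sub_le hcv hμ (a := 2 * δ) (b := δ * (c - 2)) (M := M)
    (by positivity) (by nlinarith) hbM
  have e : δ * (c - 2) - 2 * δ = δ * (c - 4) := by ring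
  rw [e] at hslope
  -- The failed test bounds the left side by `C δ c² / (2 (c - 4))`, and `c² ≤ 2 (c - 2) c` because
  -- `c ≥ 4`.
  have hq : σ * ((localWidth K μ (δ * (c - 2)) - localWidth K μ (2 * δ)) / (δ * (c - 4))) ≤ M := by
    refine le_trans ?_ hM
    rw [le_div_iff₀ (by positivity)] at hw
    rw [mul_div_assoc', div_le_div_iff₀ (by positivity) hc4]
    have h₁ : c ^ 2 ≤ 2 * ((c - 2) * c) := by nlinarith
    have h₂ : (4 - 1 / c ^ 2) * δ ^ 2 * (c - 4) * c ^ 2 ≤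
        (4 - 1 / c ^ 2) * δ ^ 2 * (c - 4) * (2 * ((c - 2) * c)) := by gcongr
    have h₃ := mul_le_mul_of_nonneg_right hw hc4.le
    linarith
  have := mul_le_mul_of_nonneg_left hslope hσ.le
  have := mul_le_mul_of_nonneg_left hq hM0.le
  linarith

end Main

end LocalPacking

open LocalPacking in
theorem theorem2p21 :
    ∃ a A : ℝ, 0 < a ∧ 0 < A ∧
      ∀ (n : ℕ) (K : Set (EuclideanSpace ℝ (Fin n))), IsCompact K → Convex ℝ K → K.Nonempty →
      ∀ σ c : ℝ, 0 < σ → 4 < c →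
      ∀ s : ℕ → Config n, IsExecution K σ c s →
      ∀ k : ℕ, 1 ≤ k →
        (TerminatesAfter s k →
          a * (Metric.diam K / (2 ^ (k - 1) * c)) ≤ worstCaseRate K σ) ∧
        (¬ TerminatesWithin s k →
          (cPrime c * (Metric.diam K / 2 ^ k) ≤ σ →
            a * min σ (Metric.diam K) ≤ worstCaseRate K σ ∧
            worstCaseRate K σ ≤ A * min σ (Metric.diam K)) ∧
          (σ ≤ cPrime c * (Metric.diam K / 2 ^ k) →
            worstCaseRate K σ ≤ A * (cPrime c * (Metric.diam K / 2 ^ k)))) := by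
  refine ⟨1 / 124, 10, by norm_num, by norm_num,
    fun n K hK hcv hne σ c hσ hc s hs k hk1 => ⟨fun hk => ?_, fun hk => ⟨fun hle => ⟨?_, ?_⟩,
      fun hle => ?_⟩⟩⟩
  · have h := scale_le_mul_worstCaseRate hK hcv hσ hc hs hk
    rw [scale] at h
    linarith
  · have h := min_le_mul_worstCaseRate hK hcv hσ
    have := worstCaseRate_nonneg K σ
    linarith
  · have h₁ := worstCaseRate_le_mul_max hK hcv hne hσ hc hs hk1 hk le_rfl hle
    have h₂ := worstCaseRate_le_diam hK hne σ
    have h₃ : 0 ≤ Metric.diam K := Metric.diam_nonneg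
    rw [mul_min_of_nonneg _ _ (by norm_num), le_min_iff]
    exact ⟨h₁, by linarith⟩
  · exact worstCaseRate_le_mul_max hK hcv hne hσ hc hs hk1 hk hle le_rfl
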